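/- Throughout, $\mathrm{Gamma}(a,b)$ has shape $a$ and rate $b$, i.e. density proportional to $w^{a-1}e^{-bw}$ on $w>0$. (1) The function $$g(p)=\frac{1}{p+1}\left[\frac{p\,\Gamma(p/2)}{\Gamma((p+1)/2)}\right]^2$$ is nondecreasing on the real interval $[1,\infty)$, and $g(1)=\pi/2$. (2) For every real $p\ge 1$, let $S=W^{1/2}$ with $W\sim\mathrm{Gamma}\left(\frac{p+1}{2},\frac18\right)$. Then $E(S)$ and $E(S^2)$ are finite and $\frac4\pi E(S)^2\ge E(S^2)$. (3) Let $p\ge1$ be an integer, $\xi\in\mathbb R^p$, $\Omega$ a symmetric positive definite $p\times p$ matrix, $\omega=\mathrm{diag}(\Omega_{11}^{1/2},\dots,\Omega_{pp}^{1/2})$, $\bar\Omega=\omega^{-1}\Omega\omega^{-1}$, and $\alpha\in\mathbb R^p$, $\alpha\neq0$. Let $X$ be a random vector with the skew double exponential distribution $SDE_p(\xi,\Omega,\alpha)$, i.e. with the distribution of $\xi+\omega S Z$, where $S$ is as in (2), $Z$ has density $2\phi_p(z;\bar\Omega)\Phi(\alpha'z)$ on $\mathbb R^p$, and $S$ and $Z$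 are independent; here $\phi_p(\cdot;\bar\Omega)$ is the density of $N_p(0,\bar\Omega)$ and $\Phi$ is the distribution function of $N(0,1)$. For a real random variable $Y$ with mean $\mu_Y$ and standard deviation $\sigma_Y>0$ let $\gamma_1(Y)=\left(E\left[\left(\frac{Y-\mu_Y}{\sigma_Y}\right)^3\right]\right)^2$. Then the coordinates of $X$ have finite third absolute moments, the covariance matrix $\Sigma$ of $X$ is positive definite, and the skewness of the projections of $X$ is maximal exactly in the direction of $\eta=\omega^{-1}\alpha$: the set of maximizers of $\gamma_1(d'X)$ over $\{d\in\mathbb R^p: d'\Sigma d=1\}$ is $$\left\{\frac{\eta}{\sqrt{\eta'\Sigma\eta}},\ -\frac{\eta}{\sqrt{\eta'\Sigma\eta}}\right\}.$$ -/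

import Mathlib

open MeasureTheory ProbabilityTheory Matrix

noncomputable section

namespace SkewDE

/-- The density `φ_p(x; Ω)` of the `p`-dimensional centred normal law with covariance matrix `Ω`. -/
def normalDensity {p : ℕ} (Ω : Matrix (Fin p) (Fin p) ℝ) (x : Fin p → ℝ) : ℝ :=
  (Real.sqrt ((2 * Real.pi) ^ p * Ω.det))⁻¹ * Real.exp (-(x ⬝ᵥ (Ω⁻¹ *ᵥ x)) / 2)

/-- The diagonal scale matrix `ω = (Ω ⊙ I)^{1/2}`. -/
def scaleDiag {p : ℕ} (Ω : Matrix (Fin p) (Fin p) ℝ) : Matrix (Fin p) (Fin p) ℝ :=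
  Matrix.diagonal fun i => Real.sqrt (Ω i i)

/-- The correlation matrix `ω⁻¹ Ω ω⁻¹`. -/
def corrMatrix {p : ℕ} (Ω : Matrix (Fin p) (Fin p) ℝ) : Matrix (Fin p) (Fin p) ℝ :=
  (scaleDiag Ω)⁻¹ * Ω * (scaleDiag Ω)⁻¹

/-- The vector `η = ω⁻¹ α`. -/
def shapeDir {p : ℕ} (Ω : Matrix (Fin p) (Fin p) ℝ) (α : Fin p → ℝ) : Fin p → ℝ :=
  (scaleDiag Ω)⁻¹ *ᵥ α

/-- The skew-normal law `SN_p(ξ, Ω, α)`, with Lebesgue density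
`2 φ_p(x - ξ; Ω) Φ(α' ω⁻¹ (x - ξ))`. -/
def skewNormal {p : ℕ} (ξ : Fin p → ℝ) (Ω : Matrix (Fin p) (Fin p) ℝ) (α : Fin p → ℝ) :
    Measure (Fin p → ℝ) :=
  volume.withDensity fun x =>
    ENNReal.ofReal (2 * normalDensity Ω (x - ξ) *
      cdf (gaussianReal 0 1) (α ⬝ᵥ ((scaleDiag Ω)⁻¹ *ᵥ (x - ξ))))

/-- The law `SMSN_p(ξ, Ω, α, H)` of `X = ξ + ω S Z`, where `S` has law `H`, where `Z` has law
`SN_p(0, ω⁻¹ Ω ω⁻¹, α)`, and where `S` and `Z` are independent. -/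
def scaleMixtureSkewNormal {p : ℕ} (ξ : Fin p → ℝ) (Ω : Matrix (Fin p) (Fin p) ℝ)
    (α : Fin p → ℝ) (H : Measure ℝ) : Measure (Fin p → ℝ) :=
  (H.prod (skewNormal 0 (corrMatrix Ω) α)).map fun sz => ξ + scaleDiag Ω *ᵥ (sz.1 • sz.2)

/-- The law of `S = W^{1/2}`, where `W` has the Gamma law of shape `(p + 1) / 2` and
rate `1 / 8`. -/
def mixingLaw (p : ℝ) : Measure ℝ :=
  (gammaMeasure ((p + 1) / 2) (1 / 8)).map Real.sqrt

/-- The multivariate skew double exponential law `SDE_p(ξ, Ω, α)`. -/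
def skewDoubleExponential {p : ℕ} (ξ : Fin p → ℝ) (Ω : Matrix (Fin p) (Fin p) ℝ)
    (α : Fin p → ℝ) : Measure (Fin p → ℝ) :=
  scaleMixtureSkewNormal ξ Ω α (mixingLaw p)

/-- `g(p) = (p Γ(p/2) / Γ((p+1)/2))² / (p + 1)`. -/
def gFun (p : ℝ) : ℝ :=
  (p * Real.Gamma (p / 2) / Real.Gamma ((p + 1) / 2)) ^ 2 / (p + 1)

/-- The skewness index `γ₁(Y) = (E[((Y - μ) / σ)³])²` of a real random variable. -/
def skewnessIndex {T : Type*} [MeasurableSpace T] (Y : T → ℝ) (P : Measure T) : ℝ :=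
  (∫ t, ((Y t - ∫ u, Y u ∂P) / Real.sqrt (Var[Y; P])) ^ 3 ∂P) ^ 2

/-- The covariance matrix of a random vector. -/
def covMatrix {T : Type*} [MeasurableSpace T] {p : ℕ} (X : T → Fin p → ℝ) (P : Measure T) :
    Matrix (Fin p) (Fin p) ℝ :=
  Matrix.of fun i j => cov[fun t => X t i, fun t => X t j; P]

/-- The feasible set `{d | d' Σ d = 1}`, with `Σ` the covariance matrix of `X`. -/
def unitVarianceDirs {T : Type*} [MeasurableSpace T] {p : ℕ} (X : T → Fin p → ℝ)
    (P : Measure T) : Set (Fin p → ℝ) :=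
  {d | d ⬝ᵥ (covMatrix X P *ᵥ d) = 1}

/-- The set of all maximisers of `γ₁(d'X)` over the vectors `d` with `d' Σ d = 1`. -/
def maxSkewDirs {T : Type*} [MeasurableSpace T] {p : ℕ} (X : T → Fin p → ℝ)
    (P : Measure T) : Set (Fin p → ℝ) :=
  {d | d ∈ unitVarianceDirs X P ∧
    IsMaxOn (fun e => skewnessIndex (fun t => e ⬝ᵥ X t) P) (unitVarianceDirs X P) d}

end SkewDE

end

namespace SkewDE

open Filter Topology NNReal

/-! ### The Gamma ratio -/

/-! With `x = p/2`, `gFun p` equals `2 Γ(x+1)² / (Γ(x+1/2) Γ(x+3/2))`. Euler's limit formula turns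
this ratio into an infinite product with factors `1 - 1/(4(x+1+j)²)`. Each factor increases with
`x`, so `gFun` is monotone. Gamma moments give `E(S)² = 2(p+1) gFun p` and `E(S²) = 4(p+1)`, so the
inequality of the second claim says exactly `gFun p ≥ π/2 = gFun 1`.

For the third claim, write `Ω = B Bᵀ`. The vector `Z` is a linear image of a standard normal vector,
reweighted by `2Φ(α'z)`. The moments of a projection are therefore those of a Gaussian variable `U`
under a weight `2Φ(Y)`, where `(U, Y)` is jointly Gaussian with `Var U = q = d'Ωd`, `Cov(U, Y) =
d'Ωη` and `Var Y = τ = η'Ωη`. Regressing `U` on `Y` and using Stein's identity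
(`selection_moments`), the first three moments are `ct`, `q` and `c(3qt - t³)`, with `c = √(2/π)`
and `t = d'Ωη/√(1+τ)`. Independence multiplies them by the moments `m₁, m₂, m₃` of `S`
(`projection_moment`).

On the set of unit variance, `m₂q = 1 + (m₁ct)²`. Eliminating `q` makes the third central moment
`ct(A + Bt²)` with `A = 3(m₃ - m₁m₂)/m₂ > 0`, and `E(S²) ≤ (4/π)E(S)²` yields `B ≥ 0`. The skewness
is then strictly increasing in `(d'Ωη)²`, and a Cauchy–Schwarz argument with its equality case
(`argmax_quadratic`) leaves only the two multiples of `η`. -/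

/-- The factor of index `j` in the product representation of `gFun`. -/
noncomputable def gammaRatioFactor (x : ℝ) (j : ℕ) : ℝ :=
  (x + 1 / 2 + j) * (x + 3 / 2 + j) / (x + 1 + j) ^ 2

lemma gammaRatioFactor_eq {x : ℝ} (hx : 0 ≤ x) (j : ℕ) :
    gammaRatioFactor x j = 1 - 1 / 4 / (x + 1 + j) ^ 2 := by
  have : x + 1 + j ≠ 0 := by positivity
  unfold gammaRatioFactor
  field_simp
  ring

lemma gammaRatioFactor_mono {x y : ℝ} (hx : 0 ≤ x) (hxy : x ≤ y) (j : ℕ) :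
    gammaRatioFactor x j ≤ gammaRatioFactor y j := by
  rw [gammaRatioFactor_eq hx, gammaRatioFactor_eq (hx.trans hxy)]
  gcongr

/-- The powers of `n` and the factorials cancel because `2(x+1) = (x+1/2) + (x+3/2)`; only the
linear factors of the denominators survive. -/
lemma gammaSeq_ratio {x : ℝ} (hx : 0 ≤ x) {n : ℕ} (hn : n ≠ 0) :
    Real.GammaSeq (x + 1) n ^ 2 / (Real.GammaSeq (x + 1 / 2) n * Real.GammaSeq (x + 3 / 2) n) =
      ∏ j ∈ Finset.range (n + 1), gammaRatioFactor x j := by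
  have hn' : (0 : ℝ) < n := by positivity
  have h1 : (∏ j ∈ Finset.range (n + 1), (x + 1 + (j : ℝ))) ≠ 0 :=
    Finset.prod_ne_zero_iff.2 fun j _ => by positivity
  have h2 : (∏ j ∈ Finset.range (n + 1), (x + 1 / 2 + (j : ℝ))) ≠ 0 :=
    Finset.prod_ne_zero_iff.2 fun j _ => by positivity
  have h3 : (∏ j ∈ Finset.range (n + 1), (x + 3 / 2 + (j : ℝ))) ≠ 0 :=
    Finset.prod_ne_zero_iff.2 fun j _ => by positivity
  have h4 : ((n : ℝ) ^ (x + 1)) ^ 2 = (n : ℝ) ^ (x + 1 / 2) * (n : ℝ) ^ (x + 3 / 2) := by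
    rw [← Real.rpow_add hn', ← Real.rpow_natCast, ← Real.rpow_mul hn'.le]
    congr 1
    push_cast
    ring
  have h5 : (n : ℝ) ^ (x + 1 / 2) ≠ 0 := (Real.rpow_pos_of_pos hn' _).ne'
  have h6 : (n : ℝ) ^ (x + 3 / 2) ≠ 0 := (Real.rpow_pos_of_pos hn' _).ne'
  have h7 : (n.factorial : ℝ) ≠ 0 := by positivity
  simp only [Real.GammaSeq, gammaRatioFactor, Finset.prod_div_distrib, Finset.prod_mul_distrib,
    Finset.prod_pow, div_pow, mul_pow, h4]
  field_simp

lemma gFun_eq {p : ℝ} (hp : 0 < p) :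
    gFun p = 2 * (Real.Gamma (p / 2 + 1) ^ 2 /
      (Real.Gamma (p / 2 + 1 / 2) * Real.Gamma (p / 2 + 3 / 2))) := by
  have h1 : Real.Gamma (p / 2 + 1) = p / 2 * Real.Gamma (p / 2) :=
    Real.Gamma_add_one (by positivity)
  have h2 : Real.Gamma (p / 2 + 3 / 2) = (p / 2 + 1 / 2) * Real.Gamma (p / 2 + 1 / 2) := by
    rw [← Real.Gamma_add_one (by positivity)]
    congr 1
    ring
  have h3 : (0 : ℝ) < Real.Gamma (p / 2 + 1 / 2) := Real.Gamma_pos_of_pos (by positivity)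
  rw [gFun, h1, h2, show (p + 1) / 2 = p / 2 + 1 / 2 by ring]
  field_simp

lemma tendsto_prod_gammaRatioFactor {x : ℝ} (hx : 0 ≤ x) :
    Tendsto (fun n : ℕ => ∏ j ∈ Finset.range (n + 1), gammaRatioFactor x j) atTop
      (𝓝 (Real.Gamma (x + 1) ^ 2 / (Real.Gamma (x + 1 / 2) * Real.Gamma (x + 3 / 2)))) := by
  refine Tendsto.congr' ?_ (((Real.GammaSeq_tendsto_Gamma (x + 1)).pow 2).div
    ((Real.GammaSeq_tendsto_Gamma (x + 1 / 2)).mul (Real.GammaSeq_tendsto_Gamma (x + 3 / 2)))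
    (mul_pos (Real.Gamma_pos_of_pos (by positivity)) (Real.Gamma_pos_of_pos (by positivity))).ne')
  filter_upwards [eventually_ne_atTop 0] with n hn
  exact gammaSeq_ratio hx hn

lemma monotoneOn_gFun : MonotoneOn gFun (Set.Ici 1) := by
  intro p hp q hq hpq
  have hp0 : (0 : ℝ) < p := lt_of_lt_of_le one_pos hp
  have hq0 : (0 : ℝ) < q := lt_of_lt_of_le one_pos hq
  rw [gFun_eq hp0, gFun_eq hq0]
  refine mul_le_mul_of_nonneg_left (le_of_tendsto_of_tendsto'
    (tendsto_prod_gammaRatioFactor (by positivity)) (tendsto_prod_gammaRatioFactor (by positivity))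
    fun n => Finset.prod_le_prod (fun j _ => ?_) fun j _ => ?_) two_pos.le
  · unfold gammaRatioFactor
    positivity
  · exact gammaRatioFactor_mono (by positivity) (by linarith) j

lemma gFun_one : gFun 1 = Real.pi / 2 := by
  rw [gFun, Real.Gamma_one_half_eq]
  norm_num [Real.Gamma_one, Real.sq_sqrt Real.pi_pos.le]

/-! ### Moments of the mixing law -/

lemma integrable_gammaPDFReal {a r : ℝ} (ha : 0 < a) (hr : 0 < r) :
    Integrable (gammaPDFReal a r) := by
  refine ⟨(measurable_gammaPDFReal a r).aestronglyMeasurable, ?_⟩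
  rw [hasFiniteIntegral_iff_ofReal (ae_of_all _ (gammaPDFReal_nonneg ha hr))]
  exact (lintegral_gammaPDF_eq_one ha hr).trans_lt ENNReal.one_lt_top

lemma integral_gammaPDFReal {a r : ℝ} (ha : 0 < a) (hr : 0 < r) :
    ∫ x, gammaPDFReal a r x = 1 := by
  rw [integral_eq_lintegral_of_nonneg_ae (ae_of_all _ (gammaPDFReal_nonneg ha hr))
    (measurable_gammaPDFReal a r).aestronglyMeasurable]
  exact congrArg ENNReal.toReal (lintegral_gammaPDF_eq_one ha hr)

/-- Multiplying by a power only shifts the shape parameter, so every moment reduces to the total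
mass of another Gamma density. The origin is excluded because of the convention `0 ^ 0 = 1`: if `a +
s = 1` and `s > 0`, the two sides differ there. -/
lemma gammaPDFReal_mul_rpow {a r : ℝ} (ha : 0 < a) (hr : 0 < r) {s : ℝ} (hs : 0 ≤ s) {x : ℝ}
    (hx : x ≠ 0) :
    gammaPDFReal a r x * x ^ s =
      Real.Gamma (a + s) / Real.Gamma a / r ^ s * gammaPDFReal (a + s) r x := by
  rcases lt_or_gt_of_ne hx with h | h
  · simp [gammaPDFReal, not_le.2 h]
  · have h1 : Real.Gamma a ≠ 0 := (Real.Gamma_pos_of_pos ha).ne'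
    have h2 : Real.Gamma (a + s) ≠ 0 := (Real.Gamma_pos_of_pos (by positivity)).ne'
    have h3 : r ^ s ≠ 0 := (Real.rpow_pos_of_pos hr s).ne'
    simp only [gammaPDFReal, h.le, if_true]
    rw [show a + s - 1 = (a - 1) + s by ring, Real.rpow_add h, Real.rpow_add hr]
    field_simp

lemma gammaMeasure_moment {a r : ℝ} (ha : 0 < a) (hr : 0 < r) {s : ℝ} (hs : 0 ≤ s) :
    Integrable (fun x : ℝ => x ^ s) (gammaMeasure a r) ∧
      ∫ x, x ^ s ∂gammaMeasure a r = Real.Gamma (a + s) / Real.Gamma a / r ^ s := by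
  have hae : (fun x => gammaPDFReal a r x * x ^ s) =ᵐ[volume]
      fun x => Real.Gamma (a + s) / Real.Gamma a / r ^ s * gammaPDFReal (a + s) r x := by
    filter_upwards [compl_mem_ae_iff.2 (measure_singleton (0 : ℝ))] with x hx
    exact gammaPDFReal_mul_rpow ha hr hs hx
  have hm : Measurable (gammaPDF a r) := (measurable_gammaPDFReal a r).ennreal_ofReal
  have htr : ∀ x, (gammaPDF a r x).toReal = gammaPDFReal a r x := fun x =>
    ENNReal.toReal_ofReal (gammaPDFReal_nonneg ha hr x)
  have htop : ∀ᵐ x, gammaPDF a r x < ⊤ := ae_of_all _ fun x => ENNReal.ofReal_lt_top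
  constructor
  · rw [gammaMeasure, integrable_withDensity_iff_integrable_smul' hm htop]
    simp only [htr, smul_eq_mul]
    exact ((integrable_gammaPDFReal (by positivity) hr).const_mul _).congr hae.symm
  · rw [gammaMeasure, integral_withDensity_eq_integral_toReal_smul hm htop]
    simp only [htr, smul_eq_mul]
    rw [integral_congr_ae hae, integral_const_mul, integral_gammaPDFReal (by positivity) hr,
      mul_one]

instance isProbabilityMeasure_mixingLaw {p : ℝ} [Fact (1 ≤ p)] :
    IsProbabilityMeasure (mixingLaw p) := by
  have hp : (1 : ℝ) ≤ p := Fact.out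
  have := isProbabilityMeasure_gammaMeasure (a := (p + 1) / 2) (r := 1 / 8) (by linarith)
    (by norm_num)
  exact Measure.isProbabilityMeasure_map (by fun_prop)

lemma mixingLaw_moment {p : ℝ} (hp : 1 ≤ p) (k : ℕ) :
    Integrable (fun s : ℝ => s ^ k) (mixingLaw p) ∧
      ∫ s, s ^ k ∂mixingLaw p =
        Real.Gamma ((p + 1) / 2 + k / 2) / Real.Gamma ((p + 1) / 2) / (1 / 8) ^ (k / 2 : ℝ) := by
  have ha : 0 < (p + 1) / 2 := by linarith
  obtain ⟨h1, h2⟩ := gammaMeasure_moment (a := (p + 1) / 2) (r := 1 / 8) ha (by norm_num)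
    (s := (k : ℝ) / 2) (by positivity)
  have hae : (fun x : ℝ => Real.sqrt x ^ k) =ᵐ[gammaMeasure ((p + 1) / 2) (1 / 8)]
      fun x => x ^ ((k : ℝ) / 2) := by
    -- The two powers agree only for nonnegative `x`: on the negative axis `Real.sqrt` is `0` while
    -- `Real.rpow` need not be.
    have hneg : gammaMeasure ((p + 1) / 2) (1 / 8) (Set.Iio 0) = 0 := by
      rw [gammaMeasure, withDensity_apply _ measurableSet_Iio]
      exact lintegral_gammaPDF_of_nonpos le_rfl
    filter_upwards [compl_mem_ae_iff.2 hneg] with x hx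
    have hx0 : 0 ≤ x := not_lt.1 hx
    rw [Real.sqrt_eq_rpow, ← Real.rpow_mul_natCast hx0]
    congr 1
    ring
  rw [mixingLaw, integrable_map_measure (by fun_prop) (by fun_prop),
    integral_map (by fun_prop) (by fun_prop)]
  exact ⟨h1.congr hae.symm, (integral_congr_ae hae).trans h2⟩

lemma mixingLaw_moment_two {p : ℝ} (hp : 1 ≤ p) :
    ∫ s, s ^ 2 ∂mixingLaw p = 4 * (p + 1) := by
  have ha : 0 < (p + 1) / 2 := by linarith
  have hG := Real.Gamma_pos_of_pos ha
  rw [(mixingLaw_moment hp 2).2]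
  norm_num [Real.Gamma_add_one ha.ne']
  field_simp
  ring

lemma mixingLaw_moment_one_pos {p : ℝ} (hp : 1 ≤ p) : 0 < ∫ s, s ∂mixingLaw p := by
  have h := (mixingLaw_moment hp 1).2
  simp only [pow_one] at h
  rw [h]
  have h1 := Real.Gamma_pos_of_pos (show 0 < (p + 1) / 2 by linarith)
  have h2 := Real.Gamma_pos_of_pos (show 0 < (p + 1) / 2 + ((1 : ℕ) : ℝ) / 2 by
    push_cast; linarith)
  positivity

/-- One step of the Gamma recursion links the third moment to the first. The exact factor matters:
`4(p+2) > 4(p+1) = E(S²)` gives `m₃ > m₁m₂`. -/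
lemma mixingLaw_moment_three {p : ℝ} (hp : 1 ≤ p) :
    ∫ s, s ^ 3 ∂mixingLaw p = 4 * (p + 2) * ∫ s, s ∂mixingLaw p := by
  have h := (mixingLaw_moment hp 1).2
  simp only [pow_one] at h
  have hG := Real.Gamma_pos_of_pos (show 0 < (p + 1) / 2 by linarith)
  rw [h, (mixingLaw_moment hp 3).2,
    show (p + 1) / 2 + ((3 : ℕ) : ℝ) / 2 = ((p + 1) / 2 + ((1 : ℕ) : ℝ) / 2) + 1 by
      push_cast; ring,
    Real.Gamma_add_one (by push_cast; linarith),
    show ((3 : ℕ) : ℝ) / 2 = ((1 : ℕ) : ℝ) / 2 + 1 by push_cast; ring,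
    Real.rpow_add (by norm_num), Real.rpow_one]
  push_cast
  field_simp
  ring

lemma mixingLaw_moment_one_sq {p : ℝ} (hp : 1 ≤ p) :
    (∫ s, s ∂mixingLaw p) ^ 2 = 2 * (p + 1) * gFun p := by
  have h := (mixingLaw_moment hp 1).2
  simp only [pow_one] at h
  have h1 : Real.Gamma (p / 2 + 1) = p / 2 * Real.Gamma (p / 2) :=
    Real.Gamma_add_one (by positivity)
  have hG := Real.Gamma_pos_of_pos (show 0 < (p + 1) / 2 by linarith)
  have h8 : ((1 / 8 : ℝ) ^ (((1 : ℕ) : ℝ) / 2)) ^ 2 = 1 / 8 := by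
    rw [← Real.rpow_mul_natCast (by norm_num)]
    norm_num
  rw [h, div_pow, h8, gFun, show (p + 1) / 2 + ((1 : ℕ) : ℝ) / 2 = p / 2 + 1 by push_cast; ring, h1]
  field_simp
  ring

/-- For the mixing law, `(4 / π) E(S)² ≥ E(S²)`. -/
lemma mixingLaw_moment_ratio {p : ℝ} (hp : 1 ≤ p) :
    ∫ s, s ^ 2 ∂mixingLaw p ≤ 4 / Real.pi * (∫ s, s ∂mixingLaw p) ^ 2 := by
  rw [mixingLaw_moment_one_sq hp, mixingLaw_moment_two hp]
  have h := monotoneOn_gFun (Set.mem_Ici.2 le_rfl) (Set.mem_Ici.2 hp) hp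
  rw [gFun_one] at h
  have hpi := Real.pi_pos
  calc 4 * (p + 1) = 4 / Real.pi * (2 * (p + 1) * (Real.pi / 2)) := by field_simp
    _ ≤ _ := by gcongr

/-- Nonnegativity of the variance of `S`; it is later used to show that the variance form of `X` is
positive definite. -/
lemma mixingLaw_moment_one_sq_le {p : ℝ} (hp : 1 ≤ p) :
    (∫ s, s ∂mixingLaw p) ^ 2 ≤ ∫ s, s ^ 2 ∂mixingLaw p := by
  have : Fact (1 ≤ p) := ⟨hp⟩
  have h2 : MemLp id 2 (mixingLaw p) :=
    (memLp_two_iff_integrable_sq (by fun_prop)).2 (mixingLaw_moment hp 2).1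
  have := variance_nonneg id (mixingLaw p)
  rw [variance_eq_sub h2] at this
  simpa using this

/-! ### One-dimensional Gaussian integrals against the normal distribution function -/

/-- The distribution function of the standard normal law. -/
noncomputable abbrev stdCDF (x : ℝ) : ℝ := cdf (gaussianReal 0 1) x

lemma measurable_stdCDF : Measurable stdCDF := (monotone_cdf _).measurable

lemma norm_stdCDF_le (x : ℝ) : ‖stdCDF x‖ ≤ 1 := by
  rw [Real.norm_of_nonneg (cdf_nonneg _ _)]
  exact cdf_le_one _ _

lemma stdCDF_eq_integral (x : ℝ) : stdCDF x = ∫ y in Set.Iic x, gaussianPDFReal 0 1 y := by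
  rw [stdCDF, cdf_eq_real, measureReal_def, gaussianReal_apply_eq_integral _ one_ne_zero,
    ENNReal.toReal_ofReal (integral_nonneg fun y => gaussianPDFReal_nonneg _ _ _)]

lemma continuous_gaussianPDFReal (m : ℝ) (v : ℝ≥0) : Continuous (gaussianPDFReal m v) := by
  unfold gaussianPDFReal
  fun_prop

lemma hasDerivAt_stdCDF (x : ℝ) : HasDerivAt stdCDF (gaussianPDFReal 0 1 x) x := by
  have hint : Integrable (gaussianPDFReal 0 1) := integrable_gaussianPDFReal 0 1
  have heq : stdCDF = fun x => stdCDF 0 + ∫ y in (0 : ℝ)..x, gaussianPDFReal 0 1 y := by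
    funext z
    rw [stdCDF_eq_integral, stdCDF_eq_integral,
      ← intervalIntegral.integral_Iic_sub_Iic hint.integrableOn hint.integrableOn]
    ring
  rw [heq]
  exact (intervalIntegral.integral_hasDerivAt_right hint.intervalIntegrable
    (continuous_gaussianPDFReal 0 1).stronglyMeasurable.stronglyMeasurableAtFilter
    (continuous_gaussianPDFReal 0 1).continuousAt).const_add _

lemma stdCDF_neg (x : ℝ) : stdCDF (-x) = 1 - stdCDF x := by
  have hno : NullSingletonClass (gaussianReal 0 1) := nullSingletonClass_gaussianReal one_ne_zero
  have h1 : (gaussianReal 0 1).real (Set.Iic (-x)) = (gaussianReal 0 1).real (Set.Ici x) := by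
    have h := gaussianReal_map_neg (μ := 0) (v := 1)
    rw [neg_zero] at h
    conv_lhs => rw [← h]
    rw [measureReal_def, Measure.map_apply (by fun_prop) measurableSet_Iic, measureReal_def]
    congr 2
    ext y
    simp
  rw [stdCDF, stdCDF, cdf_eq_real, cdf_eq_real, h1, ← Set.compl_Iio, probReal_compl_eq_one_sub
    measurableSet_Iio, measureReal_congr Iio_ae_eq_Iic]

lemma hasDerivAt_gaussianPDFReal {v : ℝ≥0} (hv : v ≠ 0) (x : ℝ) :
    HasDerivAt (fun y => -(v : ℝ) * gaussianPDFReal 0 v y) (x * gaussianPDFReal 0 v x) x := by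
  have hv' : (v : ℝ) ≠ 0 := by exact_mod_cast hv
  have h : HasDerivAt (fun y : ℝ => -(y - 0) ^ 2 / (2 * (v : ℝ))) (-x / v) x := by
    have := (((hasDerivAt_id x).sub_const 0).pow 2).neg.div_const (2 * (v : ℝ))
    convert! this using 1
    simp
    field_simp
  have := (h.exp.const_mul (Real.sqrt (2 * Real.pi * v))⁻¹).const_mul (-(v : ℝ))
  convert! this using 1
  simp only [gaussianPDFReal]
  field_simp

/-- Stein's identity for a centred normal law. -/
lemma integral_id_mul_gaussianReal {v : ℝ≥0} (hv : v ≠ 0) {f f' : ℝ → ℝ}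
    (hf : ∀ x, HasDerivAt f (f' x) x) (h0 : Integrable f (gaussianReal 0 v))
    (h1 : Integrable (fun x => x * f x) (gaussianReal 0 v))
    (h2 : Integrable f' (gaussianReal 0 v)) :
    ∫ x, x * f x ∂gaussianReal 0 v = v * ∫ x, f' x ∂gaussianReal 0 v := by
  have key : ∀ g : ℝ → ℝ, Integrable g (gaussianReal 0 v) →
      Integrable (fun x => gaussianPDFReal 0 v x * g x) := fun g hg => by
    rw [gaussianReal_of_var_ne_zero _ hv, integrable_withDensity_iff_integrable_smul'
      (measurable_gaussianPDF 0 v) (ae_of_all _ fun x => gaussianPDF_lt_top)] at hg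
    simpa only [toReal_gaussianPDF, smul_eq_mul] using hg
  have hparts := integral_mul_deriv_eq_deriv_mul_of_integrable (u := f) (u' := f')
    (v := fun y => -(v : ℝ) * gaussianPDFReal 0 v y) (v' := fun x => x * gaussianPDFReal 0 v x)
    (fun x _ => hf x) (fun x _ => hasDerivAt_gaussianPDFReal hv x)
    ((key _ h1).congr (ae_of_all _ fun x => by simp; ring))
    (((key _ h2).const_mul (-(v : ℝ))).congr (ae_of_all _ fun x => by simp; ring))
    (((key _ h0).const_mul (-(v : ℝ))).congr (ae_of_all _ fun x => by simp; ring))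
  rw [integral_gaussianReal_eq_integral_smul hv, integral_gaussianReal_eq_integral_smul hv,
    ← integral_const_mul]
  calc ∫ x, gaussianPDFReal 0 v x • (x * f x) = ∫ x, f x * (x * gaussianPDFReal 0 v x) :=
        integral_congr_ae (ae_of_all _ fun x => by simp only [smul_eq_mul]; ring)
    _ = _ := hparts
    _ = _ := by
        rw [← integral_neg]
        exact integral_congr_ae (ae_of_all _ fun x => by simp only [smul_eq_mul]; ring)

lemma integrable_pow_gaussianReal (v : ℝ≥0) (k : ℕ) :
    Integrable (fun x : ℝ => x ^ k) (gaussianReal 0 v) := by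
  have h := (memLp_id_gaussianReal' (μ := 0) (v := v) (k : ENNReal) (by simp)).integrable_norm_pow'
  refine (integrable_norm_iff (by fun_prop)).1 (h.congr (ae_of_all _ fun x => ?_))
  simp

lemma integrable_pow_mul_stdCDF (v : ℝ≥0) (k : ℕ) :
    Integrable (fun x : ℝ => x ^ k * stdCDF x) (gaussianReal 0 v) :=
  (integrable_pow_gaussianReal v k).mul_bdd measurable_stdCDF.aestronglyMeasurable
    (ae_of_all _ norm_stdCDF_le)

lemma integral_odd_gaussianReal (v : ℝ≥0) {f : ℝ → ℝ} (hf : ∀ x, f (-x) = -f x) :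
    ∫ x, f x ∂gaussianReal 0 v = 0 := by
  have h := gaussianReal_map_neg (μ := 0) (v := v)
  rw [neg_zero] at h
  have h2 : ∫ x, f x ∂gaussianReal 0 v = ∫ x, f (-x) ∂gaussianReal 0 v := by
    conv_lhs => rw [← h]
    exact (MeasurableEquiv.neg ℝ).measurableEmbedding.integral_map _
  simp only [hf, integral_neg] at h2
  linarith

lemma integral_sq_gaussianReal (v : ℝ≥0) : ∫ x, x ^ 2 ∂gaussianReal 0 v = v := by
  have h := variance_eq_sub (memLp_id_gaussianReal (μ := 0) (v := v) 2)
  rw [variance_id_gaussianReal] at h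
  simpa using h.symm

/-- `2Φ - 1` is odd, so the weight `2Φ` does not alter even moments. -/
lemma integral_even_mul_stdCDF (v : ℝ≥0) {f : ℝ → ℝ} (hf : ∀ x, f (-x) = f x)
    (hi : Integrable f (gaussianReal 0 v)) :
    ∫ x, f x * (2 * stdCDF x) ∂gaussianReal 0 v = ∫ x, f x ∂gaussianReal 0 v := by
  have h0 : ∫ x, (f x * (2 * stdCDF x) - f x) ∂gaussianReal 0 v = 0 :=
    integral_odd_gaussianReal v fun x => by
      rw [hf, stdCDF_neg]
      ring
  rw [integral_sub ?_ hi] at h0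
  · linarith
  · exact hi.mul_bdd (c := 2) (measurable_stdCDF.const_mul 2).aestronglyMeasurable
      (ae_of_all _ fun x => by
        rw [norm_mul, Real.norm_two]
        linarith [norm_stdCDF_le x])

/-- Precisions add: `1/v + 1 = (1+v)/v`. The derivative of `Φ` in Stein's identity thus turns the
law of variance `v` into a multiple of the one of variance `v/(1+v)`. -/
lemma gaussianPDFReal_mul_std (v : ℝ≥0) (hv : v ≠ 0) (x : ℝ) :
    gaussianPDFReal 0 v x * gaussianPDFReal 0 1 x =
      (Real.sqrt (2 * Real.pi * (1 + v)))⁻¹ * gaussianPDFReal 0 (v / (1 + v)) x := by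
  have hv' : (0 : ℝ) < v := by exact_mod_cast pos_iff_ne_zero.2 hv
  have hpi := Real.pi_pos
  simp only [gaussianPDFReal]
  rw [mul_mul_mul_comm, ← Real.exp_add, ← mul_assoc, ← mul_inv, ← mul_inv,
    ← Real.sqrt_mul (by positivity), ← Real.sqrt_mul (by positivity)]
  push_cast
  congr 1
  · congr 2
    field_simp
  · congr 1
    field_simp
    ring

lemma integral_mul_gaussianPDFReal_gaussianReal (v : ℝ≥0) (hv : v ≠ 0) (f : ℝ → ℝ) :
    ∫ x, f x * gaussianPDFReal 0 1 x ∂gaussianReal 0 v =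
      (Real.sqrt (2 * Real.pi * (1 + v)))⁻¹ * ∫ x, f x ∂gaussianReal 0 (v / (1 + v)) := by
  have hs : v / (1 + v) ≠ 0 := div_ne_zero hv (by positivity)
  rw [integral_gaussianReal_eq_integral_smul hv, integral_gaussianReal_eq_integral_smul hs,
    ← integral_const_mul]
  refine integral_congr_ae (ae_of_all _ fun x => ?_)
  simp only [smul_eq_mul]
  rw [← mul_assoc (Real.sqrt (2 * Real.pi * (1 + v)))⁻¹, ← gaussianPDFReal_mul_std v hv x]
  ring

lemma integrable_pow_mul_gaussianPDFReal (v : ℝ≥0) (k : ℕ) :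
    Integrable (fun x : ℝ => x ^ k * gaussianPDFReal 0 1 x) (gaussianReal 0 v) := by
  refine (integrable_pow_gaussianReal v k).mul_bdd (c := (Real.sqrt (2 * Real.pi))⁻¹)
    (measurable_gaussianPDFReal 0 1).aestronglyMeasurable (ae_of_all _ fun x => ?_)
  rw [Real.norm_of_nonneg (gaussianPDFReal_nonneg _ _ _), gaussianPDFReal]
  have : Real.exp (-(x - 0) ^ 2 / (2 * ((1 : ℝ≥0) : ℝ))) ≤ 1 := by
    rw [Real.exp_le_one_iff]
    have := sq_nonneg (x - 0)
    push_cast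
    linarith
  simpa using mul_le_mul_of_nonneg_left this (by positivity : 0 ≤ (Real.sqrt (2 * Real.pi))⁻¹)

lemma two_mul_inv_sqrt (v : ℝ≥0) : 2 * (Real.sqrt (2 * Real.pi * (1 + v)))⁻¹ =
    Real.sqrt (2 / Real.pi) / Real.sqrt (1 + v) := by
  have hpi := Real.pi_pos
  have h1 : 0 < Real.sqrt Real.pi := Real.sqrt_pos.2 hpi
  have h2 : Real.sqrt 2 ^ 2 = 2 := Real.sq_sqrt (by norm_num)
  have h3 : 0 < Real.sqrt (1 + (v : ℝ)) := Real.sqrt_pos.2 (by positivity)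
  rw [Real.sqrt_mul (by positivity), Real.sqrt_mul (by positivity), Real.sqrt_div (by norm_num)]
  field_simp
  linarith

lemma integral_mul_stdCDF (v : ℝ≥0) (hv : v ≠ 0) :
    ∫ x, x * (2 * stdCDF x) ∂gaussianReal 0 v =
      Real.sqrt (2 / Real.pi) * (v / Real.sqrt (1 + v)) := by
  -- Stein's identity with `f = Φ`.
  have h := integral_id_mul_gaussianReal hv hasDerivAt_stdCDF
    (by simpa using integrable_pow_mul_stdCDF v 0) (by simpa using integrable_pow_mul_stdCDF v 1)
    (by simpa using integrable_pow_mul_gaussianPDFReal v 0)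
  have h2 := integral_mul_gaussianPDFReal_gaussianReal v hv fun _ => 1
  simp only [one_mul, integral_const, probReal_univ, smul_eq_mul, mul_one] at h2
  calc ∫ x, x * (2 * stdCDF x) ∂gaussianReal 0 v = 2 * ∫ x, x * stdCDF x ∂gaussianReal 0 v := by
        rw [← integral_const_mul]
        congr 1
        funext x
        ring
    _ = v * (2 * (Real.sqrt (2 * Real.pi * (1 + v)))⁻¹) := by
        rw [h, h2]
        ring
    _ = _ := by
        rw [two_mul_inv_sqrt]
        ring

lemma integral_cube_mul_stdCDF (v : ℝ≥0) (hv : v ≠ 0) :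
    ∫ x, x ^ 3 * (2 * stdCDF x) ∂gaussianReal 0 v =
      Real.sqrt (2 / Real.pi) * (v / Real.sqrt (1 + v)) * (2 * v + v / (1 + v)) := by
  -- Stein's identity with `f = y²Φ(y)` reduces the cubic moment to the linear one plus a Gaussian
  -- second moment.
  have hd : ∀ x, HasDerivAt (fun y => y ^ 2 * stdCDF y)
      (x * (2 * stdCDF x) + x ^ 2 * gaussianPDFReal 0 1 x) x := fun x => by
    convert! (hasDerivAt_pow 2 x).mul (hasDerivAt_stdCDF x) using 1
    simp
    ring
  have hi1 : Integrable (fun x : ℝ => x * (2 * stdCDF x)) (gaussianReal 0 v) :=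
    ((integrable_pow_mul_stdCDF v 1).const_mul 2).congr (ae_of_all _ fun x => by simp; ring)
  have h := integral_id_mul_gaussianReal hv hd (integrable_pow_mul_stdCDF v 2)
    ((integrable_pow_mul_stdCDF v 3).congr (ae_of_all _ fun x => by ring))
    (hi1.add (integrable_pow_mul_gaussianPDFReal v 2))
  have h2 := integral_mul_gaussianPDFReal_gaussianReal v hv fun x => x ^ 2
  rw [integral_sq_gaussianReal] at h2
  rw [integral_add hi1 (integrable_pow_mul_gaussianPDFReal v 2), integral_mul_stdCDF v hv, h2] at h
  calc ∫ x, x ^ 3 * (2 * stdCDF x) ∂gaussianReal 0 v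
      = 2 * ∫ x, x * (x ^ 2 * stdCDF x) ∂gaussianReal 0 v := by
        rw [← integral_const_mul]
        congr 1
        funext x
        ring
    _ = 2 * v * (Real.sqrt (2 / Real.pi) * (v / Real.sqrt (1 + v))) +
          v * (2 * (Real.sqrt (2 * Real.pi * (1 + v)))⁻¹) * (v / (1 + v)) := by
        rw [h]
        push_cast
        ring
    _ = _ := by
        rw [two_mul_inv_sqrt]
        ring

/-! ### Selection moments of a Gaussian pair -/

section Pair

variable {Ω : Type*} [MeasurableSpace Ω] {π : Measure Ω} {U Y : Ω → ℝ}

lemma hasLaw_gaussianReal_of_centred (h : HasGaussianLaw Y π) (hY : π[Y] = 0) :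
    HasLaw Y (gaussianReal 0 Var[Y; π].toNNReal) π :=
  ⟨h.aemeasurable, by rw [h.map_eq_gaussianReal, hY]⟩

lemma integrable_pow_mul_stdCDF_comp (h : HasGaussianLaw U π) (hYm : AEMeasurable Y π) (k : ℕ) :
    Integrable (fun ω => U ω ^ k * (2 * stdCDF (Y ω))) π := by
  have := h.isProbabilityMeasure
  have h0 : Integrable (fun ω => U ω ^ k) π := by
    refine (integrable_norm_iff (h.aemeasurable.pow_const k).aestronglyMeasurable).1
      ((h.memLp (p := (k : ENNReal)) (by simp)).integrable_norm_pow'.congr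
        (ae_of_all _ fun x => ?_))
    simp
  refine h0.mul_bdd (c := 2) ((measurable_stdCDF.comp_aemeasurable hYm).const_mul
    2).aestronglyMeasurable (ae_of_all _ fun x => ?_)
  rw [norm_mul, Real.norm_two]
  linarith [norm_stdCDF_le (Y x)]

lemma integral_pow_mul_pow_mul_stdCDF (hU : HasGaussianLaw U π) (hY : HasGaussianLaw Y π)
    (hind : IndepFun U Y π) (hU0 : π[U] = 0) (hY0 : π[Y] = 0) (j k : ℕ) :
    Integrable (fun ω => U ω ^ j * (Y ω ^ k * (2 * stdCDF (Y ω)))) π ∧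
    ∫ ω, U ω ^ j * (Y ω ^ k * (2 * stdCDF (Y ω))) ∂π =
      (∫ x, x ^ j ∂gaussianReal 0 Var[U; π].toNNReal) *
        ∫ y, y ^ k * (2 * stdCDF y) ∂gaussianReal 0 Var[Y; π].toNNReal := by
  have lU := hasLaw_gaussianReal_of_centred hU hU0
  have lY := hasLaw_gaussianReal_of_centred hY hY0
  have mf : Measurable fun x : ℝ => x ^ j := by fun_prop
  have mg : Measurable fun y : ℝ => y ^ k * (2 * stdCDF y) :=
    (measurable_id.pow_const k).mul (measurable_stdCDF.const_mul 2)
  have hi := hind.comp mf mg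
  have iU : Integrable (fun ω => U ω ^ j) π := by
    have := integrable_pow_gaussianReal Var[U; π].toNNReal j
    rw [← lU.map_eq] at this
    exact this.comp_aemeasurable hU.aemeasurable
  have iY := integrable_pow_mul_stdCDF_comp hY hY.aemeasurable k
  refine ⟨hi.integrable_mul iU iY, ?_⟩
  have h1 := lU.integral_comp mf.aestronglyMeasurable
  have h2 := lY.integral_comp mg.aestronglyMeasurable
  rw [← h1, ← h2]
  exact hi.integral_mul_eq_mul_integral iU.aestronglyMeasurable iY.aestronglyMeasurable

/-- Moments of `U` under the selection weight `2 Φ(Y)`, for a centred Gaussian pair `(U, Y)`. -/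
lemma selection_moments (h : HasGaussianLaw (fun ω => (U ω, Y ω)) π)
    (hU0 : π[U] = 0) (hY0 : π[Y] = 0) (hv : 0 < Var[Y; π]) :
    ∫ ω, 2 * stdCDF (Y ω) ∂π = 1 ∧
    ∫ ω, U ω * (2 * stdCDF (Y ω)) ∂π =
      Real.sqrt (2 / Real.pi) * (cov[U, Y; π] / Real.sqrt (1 + Var[Y; π])) ∧
    ∫ ω, U ω ^ 2 * (2 * stdCDF (Y ω)) ∂π = Var[U; π] ∧
    ∫ ω, U ω ^ 3 * (2 * stdCDF (Y ω)) ∂π =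
      Real.sqrt (2 / Real.pi) *
        (3 * Var[U; π] * (cov[U, Y; π] / Real.sqrt (1 + Var[Y; π])) -
          (cov[U, Y; π] / Real.sqrt (1 + Var[Y; π])) ^ 3) := by
  have := h.isProbabilityMeasure
  have hU := h.fst
  have hY := h.snd
  set v := Var[Y; π] with hvdef
  -- `b` is the regression coefficient: the residual `R = U - bY` is uncorrelated with `Y`, hence
  -- independent of it by joint normality. Powers of `U = R + bY` then expand into products of
  -- one-dimensional integrals, and odd powers of `R` integrate to zero.
  set b := cov[U, Y; π] / v with hb
  set R : Ω → ℝ := fun ω => U ω - b * Y ω with hR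
  have hRY : HasGaussianLaw (fun ω => (R ω, Y ω)) π := by
    have := h.map_fun (((ContinuousLinearMap.fst ℝ ℝ ℝ) - b • (ContinuousLinearMap.snd ℝ ℝ ℝ)).prod
      (ContinuousLinearMap.snd ℝ ℝ ℝ))
    simpa [hR] using this
  have mU := hU.memLp_two
  have mY := hY.memLp_two
  have hR0 : π[R] = 0 := by
    simp only [hR]
    rw [integral_sub hU.integrable (hY.integrable.const_mul b), integral_const_mul, hU0, hY0]
    simp
  have hcov : cov[R, Y; π] = 0 := by
    have : R = U - fun ω => b * Y ω := rfl
    rw [this, covariance_sub_left mU (mY.const_mul b) mY, covariance_const_mul_left,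
      covariance_self hY.aemeasurable, ← hvdef, hb]
    field_simp
    ring
  have hind := hRY.indepFun_of_covariance_eq_zero hcov
  have hvarU : Var[U; π] = Var[R; π] + b ^ 2 * v := by
    have hUeq : U = R + fun ω => b * Y ω := by
      funext ω
      simp [hR]
    conv_lhs => rw [hUeq]
    rw [variance_add hRY.fst.memLp_two (mY.const_mul b), covariance_const_mul_right, hcov,
      variance_const_mul]
    ring
  set w := Var[R; π].toNNReal with hw
  have hw' : (w : ℝ) = Var[R; π] := Real.coe_toNNReal _ (variance_nonneg _ _)
  have hv' : (v.toNNReal : ℝ) = v := Real.coe_toNNReal _ hv.le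
  have hv0 : v.toNNReal ≠ 0 := (Real.toNNReal_pos.2 hv).ne'
  have key := integral_pow_mul_pow_mul_stdCDF hRY.fst hY hind hR0 hY0
  have r0 : ∫ x : ℝ, x ^ 0 ∂gaussianReal 0 w = 1 := by simp
  have r1 : ∫ x : ℝ, x ^ 1 ∂gaussianReal 0 w = 0 := integral_odd_gaussianReal w fun x => by ring
  have r2 := integral_sq_gaussianReal w
  have r3 : ∫ x : ℝ, x ^ 3 ∂gaussianReal 0 w = 0 := integral_odd_gaussianReal w fun x => by ring
  have j0 : ∫ y, y ^ 0 * (2 * stdCDF y) ∂gaussianReal 0 v.toNNReal = 1 := by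
    rw [integral_even_mul_stdCDF _ (fun x => by simp) (integrable_pow_gaussianReal _ 0)]
    simp
  have j1 := integral_mul_stdCDF _ hv0
  have j2 : ∫ y, y ^ 2 * (2 * stdCDF y) ∂gaussianReal 0 v.toNNReal = v := by
    rw [integral_even_mul_stdCDF _ (fun x => by simp) (integrable_pow_gaussianReal _ 2),
      integral_sq_gaussianReal, hv']
  have j3 := integral_cube_mul_stdCDF _ hv0
  rw [hv'] at j1 j3
  have hc : cov[U, Y; π] = b * v := by
    rw [hb]
    field_simp
  have hsq : Real.sqrt (1 + v) ^ 2 = 1 + v := Real.sq_sqrt (by linarith)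
  have hs0 : 0 < Real.sqrt (1 + v) := Real.sqrt_pos.2 (by linarith)
  refine ⟨?_, ?_, ?_, ?_⟩
  · have := (key 0 0).2
    rw [r0, j0] at this
    simpa using this
  · have e : (fun ω => U ω * (2 * stdCDF (Y ω))) = fun ω =>
        R ω ^ 1 * (Y ω ^ 0 * (2 * stdCDF (Y ω))) +
          b * (R ω ^ 0 * (Y ω ^ 1 * (2 * stdCDF (Y ω)))) := by
      funext ω
      simp only [hR]
      ring
    rw [e, integral_add (key 1 0).1 ((key 0 1).1.const_mul b), integral_const_mul, (key 1 0).2,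
      (key 0 1).2, r0, r1, hc]
    simp only [pow_one]
    rw [j1]
    ring
  · have e : (fun ω => U ω ^ 2 * (2 * stdCDF (Y ω))) = fun ω =>
        R ω ^ 2 * (Y ω ^ 0 * (2 * stdCDF (Y ω))) +
          (2 * b) * (R ω ^ 1 * (Y ω ^ 1 * (2 * stdCDF (Y ω)))) +
          b ^ 2 * (R ω ^ 0 * (Y ω ^ 2 * (2 * stdCDF (Y ω)))) := by
      funext ω
      simp only [hR]
      ring
    rw [e, integral_add ((key 2 0).1.fun_add ((key 1 1).1.const_mul _)) ((key 0 2).1.const_mul _),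
      integral_add (key 2 0).1 ((key 1 1).1.const_mul _), integral_const_mul, integral_const_mul,
      (key 2 0).2, (key 1 1).2, (key 0 2).2, r0, r1, r2, j0, j2, hvarU, hw']
    ring
  · have e : (fun ω => U ω ^ 3 * (2 * stdCDF (Y ω))) = fun ω =>
        R ω ^ 3 * (Y ω ^ 0 * (2 * stdCDF (Y ω))) +
          (3 * b) * (R ω ^ 2 * (Y ω ^ 1 * (2 * stdCDF (Y ω)))) +
          (3 * b ^ 2) * (R ω ^ 1 * (Y ω ^ 2 * (2 * stdCDF (Y ω)))) +
          b ^ 3 * (R ω ^ 0 * (Y ω ^ 3 * (2 * stdCDF (Y ω)))) := by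
      funext ω
      simp only [hR]
      ring
    rw [e, integral_add (((key 3 0).1.fun_add ((key 2 1).1.const_mul _)).fun_add ((key 1 2).1.const_mul _))
        ((key 0 3).1.const_mul _),
      integral_add ((key 3 0).1.fun_add ((key 2 1).1.const_mul _)) ((key 1 2).1.const_mul _),
      integral_add (key 3 0).1 ((key 2 1).1.const_mul _), integral_const_mul, integral_const_mul,
      integral_const_mul, (key 3 0).2, (key 2 1).2, (key 1 2).2, (key 0 3).2, r0, r1, r2, r3, j3,
      hvarU, hw', hc]
    simp only [pow_one]
    rw [j1]
    -- With `v = s² - 1` the claim becomes a rational identity in `s`.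
    generalize Real.sqrt (1 + v) = s at *
    have hvs : v = s ^ 2 - 1 := by linarith
    rw [← hsq, hvs]
    field_simp
    ring

end Pair

/-! ### The multivariate normal density -/

section Normal

variable {p : ℕ}

/-- The standard normal law on `ℝᵖ`. -/
noncomputable abbrev stdNormal (p : ℕ) : Measure (Fin p → ℝ) :=
  Measure.pi fun _ => gaussianReal 0 1

/-- A product measure is determined by its values on boxes, where the integral of the product
density factorises. -/
lemma stdNormal_eq_withDensity :
    stdNormal p = volume.withDensity fun x => ENNReal.ofReal (∏ i, gaussianPDFReal 0 1 (x i)) := by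
  refine Measure.pi_eq fun s hs => ?_
  have hnn : ∀ x : Fin p → ℝ, 0 ≤ ∏ i, gaussianPDFReal 0 1 (x i) := fun x =>
    Finset.prod_nonneg fun i _ => gaussianPDFReal_nonneg _ _ _
  rw [withDensity_apply _ (MeasurableSet.univ_pi hs), volume_pi, Measure.restrict_pi_pi,
    ← ofReal_integral_eq_lintegral_ofReal
      (Integrable.fintype_prod fun i => (integrable_gaussianPDFReal 0 1).restrict)
      (ae_of_all _ hnn),
    integral_fintype_prod_eq_prod (f := fun _ x => gaussianPDFReal 0 1 x),
    ENNReal.ofReal_prod_of_nonneg fun i _ =>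
      integral_nonneg fun x => gaussianPDFReal_nonneg _ _ _]
  exact Finset.prod_congr rfl fun i _ => (gaussianReal_apply_eq_integral 0 one_ne_zero _).symm

lemma prod_gaussianPDFReal (x : Fin p → ℝ) :
    ∏ i, gaussianPDFReal 0 1 (x i) =
      (Real.sqrt ((2 * Real.pi) ^ p))⁻¹ * Real.exp (-(x ⬝ᵥ x) / 2) := by
  simp only [gaussianPDFReal, Finset.prod_mul_distrib, ← Real.exp_sum, Finset.prod_const,
    Finset.card_univ, Fintype.card_fin, dotProduct]
  congr 1
  · rw [inv_pow]
    congr 1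
    rw [NNReal.coe_one, mul_one, eq_comm, Real.sqrt_eq_iff_mul_self_eq (by positivity)
      (by positivity), ← mul_pow, Real.mul_self_sqrt (by positivity)]
  · congr 1
    rw [neg_div, Finset.sum_div, ← Finset.sum_neg_distrib]
    refine Finset.sum_congr rfl fun i _ => ?_
    push_cast
    ring

lemma abs_det_mul_normalDensity {A : Matrix (Fin p) (Fin p) ℝ} (hA : A.det ≠ 0) (x : Fin p → ℝ) :
    |A.det| * normalDensity (A * Aᵀ) (A *ᵥ x) = ∏ i, gaussianPDFReal 0 1 (x i) := by
  have hu : IsUnit A.det := isUnit_iff_ne_zero.2 hA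
  have hq : (A *ᵥ x) ⬝ᵥ ((A * Aᵀ)⁻¹ *ᵥ (A *ᵥ x)) = x ⬝ᵥ x := by
    rw [mulVec_mulVec, Matrix.mul_inv_rev, Matrix.mul_assoc, Matrix.nonsing_inv_mul _ hu,
      Matrix.mul_one, ← vecMul_transpose, ← dotProduct_mulVec, mulVec_mulVec,
      Matrix.mul_nonsing_inv _ (by rwa [det_transpose]), one_mulVec]
  have hs : Real.sqrt ((2 * Real.pi) ^ p * (A * Aᵀ).det) =
      Real.sqrt ((2 * Real.pi) ^ p) * |A.det| := by
    rw [det_mul, det_transpose, Real.sqrt_mul (by positivity), Real.sqrt_mul_self_eq_abs]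
  have : |A.det| ≠ 0 := abs_ne_zero.2 hA
  rw [prod_gaussianPDFReal, normalDensity, hq, hs, mul_inv]
  field_simp

lemma measurable_normalDensity (Ω : Matrix (Fin p) (Fin p) ℝ) : Measurable (normalDensity Ω) := by
  refine Continuous.measurable ?_
  unfold normalDensity
  fun_prop

/-- The density `φ_p(·; A Aᵀ)` is that of the image of the standard normal law by `A`. -/
lemma map_mulVec_stdNormal {A : Matrix (Fin p) (Fin p) ℝ} (hA : A.det ≠ 0) :
    (stdNormal p).map (A *ᵥ ·) =
      volume.withDensity fun x => ENNReal.ofReal (normalDensity (A * Aᵀ) x) := by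
  have hm : Measurable fun x : Fin p → ℝ => A *ᵥ x := (by fun_prop : Continuous _).measurable
  have hf : Measurable fun x => ENNReal.ofReal (normalDensity (A * Aᵀ) x) :=
    (measurable_normalDensity _).ennreal_ofReal
  have hvol : (volume : Measure (Fin p → ℝ)).map (A *ᵥ ·) =
      ENNReal.ofReal (|A.det|⁻¹) • volume := by
    have := Real.map_matrix_volume_pi_eq_smul_volume_pi hA
    rw [abs_inv] at this
    exact this
  ext s hs
  have hd : 0 < |A.det| := abs_pos.2 hA
  rw [Measure.map_apply hm hs, stdNormal_eq_withDensity, withDensity_apply _ (hm hs),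
    withDensity_apply _ hs]
  simp only [← abs_det_mul_normalDensity hA, ENNReal.ofReal_mul hd.le]
  rw [lintegral_const_mul _ (by exact hf.comp hm), ← setLIntegral_map hs hf hm, hvol,
    Measure.restrict_smul, lintegral_smul_measure, smul_eq_mul, ← mul_assoc,
    ← ENNReal.ofReal_mul hd.le, mul_inv_cancel₀ hd.ne', ENNReal.ofReal_one, one_mul]

lemma hasGaussianLaw_id_stdNormal : HasGaussianLaw (fun x : Fin p → ℝ => x) (stdNormal p) := by
  have hi : iIndepFun (fun (i : Fin p) (x : Fin p → ℝ) => x i) (stdNormal p) :=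
    iIndepFun_pi (X := fun _ => id) fun _ => aemeasurable_id
  refine hi.hasGaussianLaw fun i => ?_
  exact HasLaw.hasGaussianLaw (measurePreserving_eval (fun _ : Fin p => gaussianReal 0 1) i).hasLaw

lemma hasGaussianLaw_dotProduct_pair (u v : Fin p → ℝ) :
    HasGaussianLaw (fun x : Fin p → ℝ => (u ⬝ᵥ x, v ⬝ᵥ x)) (stdNormal p) := by
  let L : (Fin p → ℝ) →L[ℝ] ℝ × ℝ := LinearMap.toContinuousLinearMap
    { toFun := fun x => (u ⬝ᵥ x, v ⬝ᵥ x)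
      map_add' := fun x y => by simp [dotProduct_add]
      map_smul' := fun c x => by simp [dotProduct_smul] }
  exact hasGaussianLaw_id_stdNormal.map_fun L

lemma integral_dotProduct_stdNormal (u : Fin p → ℝ) : ∫ x, u ⬝ᵥ x ∂stdNormal p = 0 := by
  simp only [dotProduct]
  rw [integral_finsetSum _ fun i _ =>
    ((hasGaussianLaw_id_stdNormal.eval i).integrable).const_mul (u i)]
  refine Finset.sum_eq_zero fun i _ => ?_
  rw [integral_const_mul, integral_eval]
  simp

lemma covariance_dotProduct_stdNormal (u v : Fin p → ℝ) :
    cov[fun x => u ⬝ᵥ x, fun x => v ⬝ᵥ x; stdNormal p] = u ⬝ᵥ v := by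
  have hm : ∀ i : Fin p, MemLp (fun x : Fin p → ℝ => x i) 2 (stdNormal p) := fun i =>
    (hasGaussianLaw_id_stdNormal.eval i).memLp_two
  have hi : iIndepFun (fun (i : Fin p) (x : Fin p → ℝ) => x i) (stdNormal p) :=
    iIndepFun_pi (X := fun _ => id) fun _ => aemeasurable_id
  have hc : ∀ i j : Fin p, cov[fun x => x i, fun x => x j; stdNormal p] = if i = j then 1 else 0 := by
    intro i j
    split_ifs with h
    · subst h
      have hl : HasLaw (fun x : Fin p → ℝ => x i) (gaussianReal 0 1) (stdNormal p) :=
        (measurePreserving_eval (fun _ : Fin p => gaussianReal 0 1) i).hasLaw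
      rw [covariance_self (hm i).aestronglyMeasurable.aemeasurable, hl.variance_eq, variance_id_gaussianReal]
      simp
    · exact (hi.indepFun h).covariance_eq_zero (hm i) (hm j)
  simp only [dotProduct]
  rw [covariance_fun_sum_fun_sum (fun i => (hm i).const_mul (u i))
    fun i => (hm i).const_mul (v i)]
  refine Finset.sum_congr rfl fun i _ => ?_
  simp only [covariance_const_mul_left, covariance_const_mul_right, hc]
  simp [mul_comm]

end Normal

/-! ### Moments of the skew-normal law -/

section SkewNormal

variable {p : ℕ} {Ω : Matrix (Fin p) (Fin p) ℝ} {α : Fin p → ℝ}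

open scoped MatrixOrder in
lemma _root_.Matrix.PosDef.exists_mul_transpose (hΩ : Ω.PosDef) :
    ∃ B : Matrix (Fin p) (Fin p) ℝ, B.det ≠ 0 ∧ Ω = B * Bᵀ := by
  have h1 : CFC.sqrt Ω * CFC.sqrt Ω = Ω := CFC.sqrt_mul_sqrt_self _ hΩ.posSemidef.nonneg
  have h2 : (CFC.sqrt Ω)ᵀ = CFC.sqrt Ω := by
    have := (Matrix.nonneg_iff_posSemidef.1 (CFC.sqrt_nonneg Ω)).isHermitian
    rwa [Matrix.IsHermitian, conjTranspose_eq_transpose_of_trivial] at this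
  refine ⟨CFC.sqrt Ω, fun h => ?_, by rw [h2, h1]⟩
  have h3 := hΩ.det_pos
  rw [← h1, det_mul, h, zero_mul] at h3
  exact h3.false

lemma scaleDiag_det_ne_zero (hΩ : Ω.PosDef) : (scaleDiag Ω).det ≠ 0 := by
  rw [scaleDiag, det_diagonal]
  exact Finset.prod_ne_zero_iff.2 fun i _ => (Real.sqrt_pos.2 hΩ.diag_pos).ne'

lemma scaleDiag_inv (hΩ : Ω.PosDef) :
    (scaleDiag Ω)⁻¹ = diagonal fun i => (Real.sqrt (Ω i i))⁻¹ := by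
  refine inv_eq_right_inv ?_
  rw [scaleDiag, diagonal_mul_diagonal, ← diagonal_one]
  congr 1
  funext i
  exact mul_inv_cancel₀ (Real.sqrt_pos.2 hΩ.diag_pos).ne'

/-- A correlation matrix has unit diagonal, so `skewNormal` applied to it does not rescale the
argument of `Φ` again. -/
lemma scaleDiag_corrMatrix (hΩ : Ω.PosDef) : scaleDiag (corrMatrix Ω) = 1 := by
  rw [corrMatrix, scaleDiag_inv hΩ, scaleDiag, ← diagonal_one]
  congr 1
  funext i
  have h : 0 < Real.sqrt (Ω i i) := Real.sqrt_pos.2 hΩ.diag_pos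
  have hs := Real.mul_self_sqrt (hΩ.diag_pos (i := i)).le
  rw [mul_diagonal, diagonal_mul, Real.sqrt_eq_one]
  field_simp
  rw [sq, hs]

lemma skewNormal_corrMatrix_eq {B : Matrix (Fin p) (Fin p) ℝ} (hB : B.det ≠ 0)
    (hΩ : (B * Bᵀ).PosDef) (α : Fin p → ℝ) :
    skewNormal 0 (corrMatrix (B * Bᵀ)) α =
      ((stdNormal p).map (((scaleDiag (B * Bᵀ))⁻¹ * B) *ᵥ ·)).withDensity
        fun z => ENNReal.ofReal (2 * stdCDF (α ⬝ᵥ z)) := by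
  have hA : ((scaleDiag (B * Bᵀ))⁻¹ * B).det ≠ 0 := by
    rw [det_mul, det_nonsing_inv, Ring.inverse_eq_inv']
    exact mul_ne_zero (inv_ne_zero (scaleDiag_det_ne_zero hΩ)) hB
  have hAA : (scaleDiag (B * Bᵀ))⁻¹ * B * ((scaleDiag (B * Bᵀ))⁻¹ * B)ᵀ =
      corrMatrix (B * Bᵀ) := by
    have : ((scaleDiag (B * Bᵀ))⁻¹)ᵀ = (scaleDiag (B * Bᵀ))⁻¹ := by
      rw [scaleDiag_inv hΩ, diagonal_transpose]
    rw [transpose_mul, this, corrMatrix]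
    simp only [Matrix.mul_assoc]
  have hd : Continuous fun z : Fin p → ℝ => α ⬝ᵥ z := by fun_prop
  have hm2 : Measurable fun z : Fin p → ℝ => ENNReal.ofReal (2 * stdCDF (α ⬝ᵥ z)) :=
    ((measurable_stdCDF.comp hd.measurable).const_mul 2).ennreal_ofReal
  rw [map_mulVec_stdNormal hA, hAA, ← withDensity_mul _
    (measurable_normalDensity _).ennreal_ofReal hm2, skewNormal, scaleDiag_corrMatrix hΩ]
  congr 1
  funext z
  have h0 : 0 ≤ normalDensity (corrMatrix (B * Bᵀ)) z := by
    unfold normalDensity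
    positivity
  simp only [sub_zero, inv_one, one_mulVec, Pi.mul_apply]
  rw [← ENNReal.ofReal_mul h0]
  congr 1
  ring

lemma dotProduct_scaled_mulVec {B : Matrix (Fin p) (Fin p) ℝ} (hΩ : (B * Bᵀ).PosDef)
    (u x : Fin p → ℝ) :
    u ⬝ᵥ (((scaleDiag (B * Bᵀ))⁻¹ * B) *ᵥ x) =
      (Bᵀ *ᵥ ((scaleDiag (B * Bᵀ))⁻¹ *ᵥ u)) ⬝ᵥ x := by
  have : ((scaleDiag (B * Bᵀ))⁻¹)ᵀ = (scaleDiag (B * Bᵀ))⁻¹ := by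
    rw [scaleDiag_inv hΩ, diagonal_transpose]
  rw [dotProduct_mulVec, ← mulVec_transpose, transpose_mul, this, mulVec_mulVec]

lemma toReal_weight (x : ℝ) : (ENNReal.ofReal (2 * stdCDF x)).toReal = 2 * stdCDF x :=
  ENNReal.toReal_ofReal (mul_nonneg two_pos.le (cdf_nonneg _ _))

lemma transpose_mulVec_dotProduct (B : Matrix (Fin p) (Fin p) ℝ) (d e : Fin p → ℝ) :
    (Bᵀ *ᵥ d) ⬝ᵥ (Bᵀ *ᵥ e) = d ⬝ᵥ ((B * Bᵀ) *ᵥ e) := by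
  rw [← mulVec_mulVec, dotProduct_mulVec d, mulVec_transpose B d]

/-- The moments of `(ω d)' Z` for `Z` of law `SN_p(0, ω⁻¹ Ω ω⁻¹, α)`. -/
lemma skewNormal_moments (hΩ : Ω.PosDef) (hα : α ≠ 0) (d : Fin p → ℝ) :
    IsProbabilityMeasure (skewNormal 0 (corrMatrix Ω) α) ∧
    (∀ k : ℕ, Integrable (fun z => ((scaleDiag Ω *ᵥ d) ⬝ᵥ z) ^ k)
      (skewNormal 0 (corrMatrix Ω) α)) ∧
    ∀ t : ℝ, t = d ⬝ᵥ (Ω *ᵥ shapeDir Ω α) /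
      Real.sqrt (1 + shapeDir Ω α ⬝ᵥ (Ω *ᵥ shapeDir Ω α)) →
    ∫ z, ((scaleDiag Ω *ᵥ d) ⬝ᵥ z) ^ 1 ∂skewNormal 0 (corrMatrix Ω) α =
      Real.sqrt (2 / Real.pi) * t ∧
    ∫ z, ((scaleDiag Ω *ᵥ d) ⬝ᵥ z) ^ 2 ∂skewNormal 0 (corrMatrix Ω) α = d ⬝ᵥ (Ω *ᵥ d) ∧
    ∫ z, ((scaleDiag Ω *ᵥ d) ⬝ᵥ z) ^ 3 ∂skewNormal 0 (corrMatrix Ω) α =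
      Real.sqrt (2 / Real.pi) * (3 * (d ⬝ᵥ (Ω *ᵥ d)) * t - t ^ 3) := by
  obtain ⟨B, hB, rfl⟩ := hΩ.exists_mul_transpose
  set η := shapeDir (B * Bᵀ) α with hη
  have hη0 : η ≠ 0 := fun h => hα <| by
    have := congrArg (scaleDiag (B * Bᵀ) *ᵥ ·) h
    simpa [hη, shapeDir, mulVec_mulVec, Matrix.mul_nonsing_inv _
      (isUnit_iff_ne_zero.2 (scaleDiag_det_ne_zero hΩ))] using this
  have hcont : Continuous fun x : Fin p → ℝ => ((scaleDiag (B * Bᵀ))⁻¹ * B) *ᵥ x := by fun_prop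
  have hd : Continuous fun z : Fin p → ℝ => α ⬝ᵥ z := by fun_prop
  have hw : Measurable fun z : Fin p → ℝ => ENNReal.ofReal (2 * stdCDF (α ⬝ᵥ z)) :=
    ((measurable_stdCDF.comp hd.measurable).const_mul 2).ennreal_ofReal
  have hwr : Measurable fun z : Fin p → ℝ => 2 * stdCDF (α ⬝ᵥ z) :=
    (measurable_stdCDF.comp hd.measurable).const_mul 2
  have huz : Continuous fun z : Fin p → ℝ => (scaleDiag (B * Bᵀ) *ᵥ d) ⬝ᵥ z := by fun_prop
  have hwk : ∀ k : ℕ, Measurable fun z : Fin p → ℝ =>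
      2 * stdCDF (α ⬝ᵥ z) * ((scaleDiag (B * Bᵀ) *ᵥ d) ⬝ᵥ z) ^ k := fun k =>
    hwr.mul (huz.measurable.pow_const k)
  have hu : ∀ x, (scaleDiag (B * Bᵀ) *ᵥ d) ⬝ᵥ (((scaleDiag (B * Bᵀ))⁻¹ * B) *ᵥ x) =
      (Bᵀ *ᵥ d) ⬝ᵥ x := fun x => by
    rw [dotProduct_scaled_mulVec hΩ, mulVec_mulVec d, Matrix.nonsing_inv_mul _
      (isUnit_iff_ne_zero.2 (scaleDiag_det_ne_zero hΩ)), one_mulVec]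
  have hαx : ∀ x, α ⬝ᵥ (((scaleDiag (B * Bᵀ))⁻¹ * B) *ᵥ x) = (Bᵀ *ᵥ η) ⬝ᵥ x :=
    fun x => dotProduct_scaled_mulVec hΩ α x
  have hG := hasGaussianLaw_dotProduct_pair (Bᵀ *ᵥ d) (Bᵀ *ᵥ η)
  have hprob : IsProbabilityMeasure (stdNormal p) := inferInstance
  have hvar : ∀ e : Fin p → ℝ, Var[fun x => (Bᵀ *ᵥ e) ⬝ᵥ x; stdNormal p] =
      e ⬝ᵥ ((B * Bᵀ) *ᵥ e) := fun e => by
    rw [← covariance_self (by fun_prop), covariance_dotProduct_stdNormal,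
      transpose_mulVec_dotProduct]
  have hτ : 0 < Var[fun x => (Bᵀ *ᵥ η) ⬝ᵥ x; stdNormal p] := by
    rw [hvar]
    simpa using hΩ.dotProduct_mulVec_pos hη0
  have hsel := selection_moments hG (integral_dotProduct_stdNormal _)
    (integral_dotProduct_stdNormal _) hτ
  rw [covariance_dotProduct_stdNormal, transpose_mulVec_dotProduct, hvar, hvar] at hsel
  obtain ⟨s0, s1, s2, s3⟩ := hsel
  have hint : ∀ k : ℕ, ∫ z, ((scaleDiag (B * Bᵀ) *ᵥ d) ⬝ᵥ z) ^ k
      ∂skewNormal 0 (corrMatrix (B * Bᵀ)) α =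
        ∫ x, ((Bᵀ *ᵥ d) ⬝ᵥ x) ^ k * (2 * stdCDF ((Bᵀ *ᵥ η) ⬝ᵥ x)) ∂stdNormal p := fun k => by
    rw [skewNormal_corrMatrix_eq hB hΩ, integral_withDensity_eq_integral_toReal_smul hw
      (ae_of_all _ fun z => ENNReal.ofReal_lt_top)]
    simp only [toReal_weight, smul_eq_mul]
    rw [integral_map hcont.measurable.aemeasurable
      (hwk k).aestronglyMeasurable]
    simp only [hu, hαx]
    simp only [mul_comm]
  have hintegrable : ∀ k : ℕ, Integrable (fun z => ((scaleDiag (B * Bᵀ) *ᵥ d) ⬝ᵥ z) ^ k)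
      (skewNormal 0 (corrMatrix (B * Bᵀ)) α) := fun k => by
    rw [skewNormal_corrMatrix_eq hB hΩ, integrable_withDensity_iff_integrable_smul' hw
      (ae_of_all _ fun z => ENNReal.ofReal_lt_top)]
    simp only [toReal_weight, smul_eq_mul]
    rw [integrable_map_measure (hwk k).aestronglyMeasurable
      hcont.measurable.aemeasurable]
    refine (integrable_pow_mul_stdCDF_comp hG.fst hG.snd.aemeasurable k).congr
      (ae_of_all _ fun x => ?_)
    simp only [Function.comp_apply, hu, hαx]
    ring
  refine ⟨⟨?_⟩, hintegrable, ?_⟩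
  -- The zeroth moment is the total mass.
  · have h1 := hint 0
    simp only [pow_zero, one_mul] at h1
    rw [s0] at h1
    simpa [measureReal_def, ENNReal.toReal_eq_one_iff] using h1
  · rintro t rfl
    refine ⟨?_, ?_, ?_⟩
    · rw [hint 1]
      simpa only [pow_one] using s1
    · rw [hint 2, s2]
    · rw [hint 3, s3]

end SkewNormal

/-! ### Projections of the skew double exponential law -/

section Projections

variable {T : Type*} [MeasurableSpace T] {P : Measure T} {p : ℕ} {ξ : Fin p → ℝ}
  {Ω : Matrix (Fin p) (Fin p) ℝ} {α : Fin p → ℝ} {X : T → Fin p → ℝ}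

lemma isProbabilityMeasure_of_hasLaw (hp : 1 ≤ p) (hΩ : Ω.PosDef) (hα : α ≠ 0)
    (hX : HasLaw X (skewDoubleExponential ξ Ω α) P) : IsProbabilityMeasure P := by
  have := (skewNormal_moments hΩ hα 0).1
  have : Fact ((1 : ℝ) ≤ p) := ⟨by exact_mod_cast hp⟩
  have : IsProbabilityMeasure (skewDoubleExponential ξ Ω α) :=
    Measure.isProbabilityMeasure_map (by fun_prop : Continuous _).measurable.aemeasurable
  exact hX.isProbabilityMeasure

lemma projection_moment (hp : 1 ≤ p) (hΩ : Ω.PosDef) (hα : α ≠ 0)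
    (hX : HasLaw X (skewDoubleExponential ξ Ω α) P) (d : Fin p → ℝ) (k : ℕ) :
    Integrable (fun t => (d ⬝ᵥ X t - d ⬝ᵥ ξ) ^ k) P ∧
    ∫ t, (d ⬝ᵥ X t - d ⬝ᵥ ξ) ^ k ∂P = (∫ s, s ^ k ∂mixingLaw p) *
      ∫ z, ((scaleDiag Ω *ᵥ d) ⬝ᵥ z) ^ k ∂skewNormal 0 (corrMatrix Ω) α := by
  obtain ⟨hν, hνi, -⟩ := skewNormal_moments hΩ hα d
  have hp' : (1 : ℝ) ≤ p := by exact_mod_cast hp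
  have : Fact ((1 : ℝ) ≤ p) := ⟨hp'⟩
  have hf : Measurable fun sz : ℝ × (Fin p → ℝ) => ξ + scaleDiag Ω *ᵥ (sz.1 • sz.2) :=
    (by fun_prop : Continuous _).measurable
  have hg : Measurable fun x : Fin p → ℝ => (d ⬝ᵥ x - d ⬝ᵥ ξ) ^ k :=
    (by fun_prop : Continuous _).measurable
  have hproj : ∀ sz : ℝ × (Fin p → ℝ),
      (d ⬝ᵥ (ξ + scaleDiag Ω *ᵥ (sz.1 • sz.2)) - d ⬝ᵥ ξ) ^ k =
        sz.1 ^ k * ((scaleDiag Ω *ᵥ d) ⬝ᵥ sz.2) ^ k := fun sz => by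
    have h : (scaleDiag Ω)ᵀ = scaleDiag Ω := diagonal_transpose _
    rw [dotProduct_add, add_sub_cancel_left, mulVec_smul, dotProduct_smul, dotProduct_mulVec,
      ← mulVec_transpose, h, smul_eq_mul, mul_pow]
  -- The centred projection is `S · (ωd)'Z`; its `k`-th power is a product of functions of
  -- independent variables.
  have hprod := (mixingLaw_moment hp' k).1.mul_prod (hνi k)
  constructor
  · refine Integrable.comp_aemeasurable (f := X) (g := fun x => (d ⬝ᵥ x - d ⬝ᵥ ξ) ^ k) ?_
      hX.aemeasurable
    rw [hX.map_eq, skewDoubleExponential, scaleMixtureSkewNormal,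
      integrable_map_measure hg.aestronglyMeasurable hf.aemeasurable]
    exact hprod.congr (ae_of_all _ fun sz => (hproj sz).symm)
  · have h := hX.integral_comp hg.aestronglyMeasurable
    rw [skewDoubleExponential, scaleMixtureSkewNormal,
      integral_map hf.aemeasurable hg.aestronglyMeasurable] at h
    simp only [hproj] at h
    rw [integral_prod_mul (fun s : ℝ => s ^ k)
      fun z : Fin p → ℝ => ((scaleDiag Ω *ᵥ d) ⬝ᵥ z) ^ k] at h
    exact h

lemma aemeasurable_projection (hX : HasLaw X (skewDoubleExponential ξ Ω α) P) (d : Fin p → ℝ) :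
    AEMeasurable (fun t => d ⬝ᵥ X t) P :=
  (by fun_prop : Continuous fun x : Fin p → ℝ => d ⬝ᵥ x).measurable.comp_aemeasurable
    hX.aemeasurable

lemma memLp_projection (hp : 1 ≤ p) (hΩ : Ω.PosDef) (hα : α ≠ 0)
    (hX : HasLaw X (skewDoubleExponential ξ Ω α) P) (d : Fin p → ℝ) :
    MemLp (fun t => d ⬝ᵥ X t) 3 P := by
  have := isProbabilityMeasure_of_hasLaw hp hΩ hα hX
  have hW : MemLp (fun t => d ⬝ᵥ X t - d ⬝ᵥ ξ) 3 P := by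
    refine (integrable_norm_rpow_iff ((aemeasurable_projection hX d).sub_const _).aestronglyMeasurable
      (by norm_num) (by norm_num)).1 ((projection_moment hp hΩ hα hX d 3).1.norm.congr
        (ae_of_all _ fun t => ?_))
    beta_reduce
    rw [norm_pow, ENNReal.toReal_ofNat, ← Real.rpow_natCast, Nat.cast_ofNat]
  refine (hW.add (memLp_const (d ⬝ᵥ ξ))).ae_eq (ae_of_all _ fun t => ?_)
  simp

lemma integral_central_cube [IsProbabilityMeasure P] {W : T → ℝ} (h1 : Integrable W P)
    (h2 : Integrable (fun t => W t ^ 2) P) (h3 : Integrable (fun t => W t ^ 3) P) :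
    ∫ t, (W t - ∫ u, W u ∂P) ^ 3 ∂P =
      ∫ t, W t ^ 3 ∂P - 3 * (∫ t, W t ^ 2 ∂P) * (∫ t, W t ∂P) + 2 * (∫ t, W t ∂P) ^ 3 := by
  set m := ∫ u, W u ∂P
  have e : (fun t => (W t - m) ^ 3) = fun t =>
      W t ^ 3 + (-3 * m) * W t ^ 2 + (3 * m ^ 2) * W t + -m ^ 3 := by
    funext t
    ring
  have i2 := h2.const_mul (-3 * m)
  have i1 := h1.const_mul (3 * m ^ 2)
  rw [e, integral_add ((h3.fun_add i2).fun_add i1) (integrable_const _),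
    integral_add (h3.fun_add i2) i1, integral_add h3 i2, integral_const_mul, integral_const_mul,
    integral_const, probReal_univ]
  simp only [smul_eq_mul, one_mul]
  ring

lemma projection_var_and_third (hp : 1 ≤ p) (hΩ : Ω.PosDef) (hα : α ≠ 0)
    (hX : HasLaw X (skewDoubleExponential ξ Ω α) P) (d : Fin p → ℝ) {t q c m₁ m₂ m₃ : ℝ}
    (ht : t = d ⬝ᵥ (Ω *ᵥ shapeDir Ω α) / Real.sqrt (1 + shapeDir Ω α ⬝ᵥ (Ω *ᵥ shapeDir Ω α)))
    (hq : q = d ⬝ᵥ (Ω *ᵥ d)) (hc : c = Real.sqrt (2 / Real.pi))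
    (h₁ : m₁ = ∫ s, s ∂mixingLaw p) (h₂ : m₂ = ∫ s, s ^ 2 ∂mixingLaw p)
    (h₃ : m₃ = ∫ s, s ^ 3 ∂mixingLaw p) :
    Var[fun t => d ⬝ᵥ X t; P] = m₂ * q - (m₁ * c * t) ^ 2 ∧
    ∫ ω, (d ⬝ᵥ X ω - ∫ u, d ⬝ᵥ X u ∂P) ^ 3 ∂P =
      m₃ * (c * (3 * q * t - t ^ 3)) - 3 * (m₂ * q) * (m₁ * c * t) + 2 * (m₁ * c * t) ^ 3 := by
  have := isProbabilityMeasure_of_hasLaw hp hΩ hα hX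
  have hk := projection_moment hp hΩ hα hX d
  obtain ⟨e1, e2, e3⟩ := (skewNormal_moments hΩ hα d).2.2 t ht
  obtain ⟨i1, k1⟩ := hk 1
  obtain ⟨i2, k2⟩ := hk 2
  obtain ⟨i3, k3⟩ := hk 3
  rw [e1] at k1
  rw [e2, ← h₂, ← hq] at k2
  rw [e3, ← h₃, ← hq, ← hc] at k3
  simp only [pow_one] at i1 k1
  rw [← h₁, ← hc, ← mul_assoc] at k1
  have hmean : ∫ u, d ⬝ᵥ X u ∂P = d ⬝ᵥ ξ + m₁ * c * t := by
    have hi : Integrable (fun u => d ⬝ᵥ X u) P :=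
      (memLp_projection hp hΩ hα hX d).integrable (by norm_num)
    rw [integral_sub hi (integrable_const _), integral_const, probReal_univ, one_smul] at k1
    linarith
  constructor
  · have hW : MemLp (fun t => d ⬝ᵥ X t - d ⬝ᵥ ξ) 2 P := (memLp_two_iff_integrable_sq
      ((aemeasurable_projection hX d).sub_const _).aestronglyMeasurable).2 i2
    rw [← variance_sub_const (aemeasurable_projection hX d).aestronglyMeasurable (d ⬝ᵥ ξ),
      variance_eq_sub hW, k1]
    congr 1
  · have h := integral_central_cube i1 i2 i3
    rw [k1, k2, k3] at h
    rw [← h, hmean]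
    congr 1
    funext ω
    ring

/-- Identifies the constraint `d'Σd = 1` with unit variance of the projection, and makes positivity
of variances the positive definiteness of `Σ`. -/
lemma covMatrix_quadratic (hp : 1 ≤ p) (hΩ : Ω.PosDef) (hα : α ≠ 0)
    (hX : HasLaw X (skewDoubleExponential ξ Ω α) P) (d : Fin p → ℝ) :
    d ⬝ᵥ (covMatrix X P *ᵥ d) = Var[fun t => d ⬝ᵥ X t; P] := by
  have := isProbabilityMeasure_of_hasLaw hp hΩ hα hX
  have hm : ∀ i, MemLp (fun t => X t i) 2 P := fun i => by
    have := memLp_projection hp hΩ hα hX (Pi.single i 1)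
    simp only [single_dotProduct, one_mul] at this
    exact this.mono_exponent (by norm_num)
  rw [← covariance_self (aemeasurable_projection hX d)]
  simp only [dotProduct]
  rw [covariance_fun_sum_fun_sum (fun i => (hm i).const_mul (d i))
    fun i => (hm i).const_mul (d i)]
  simp only [covariance_const_mul_left, covariance_const_mul_right, mulVec, dotProduct, covMatrix,
    Matrix.of_apply, Finset.mul_sum]
  refine Finset.sum_congr rfl fun i _ => Finset.sum_congr rfl fun j _ => ?_
  ring

end Projections

/-! ### Maximisation over the unit-variance directions -/

/-- Split `d` into its `Ω`-orthogonal projection on `η` and a residual. Then `V` is `a` times the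
squared `Ω`-norm of the residual plus a positive multiple of `(d'Ωη)²`. On `V = 1` the latter is
largest exactly when the residual vanishes, i.e. when `d` is a multiple of `η`, and normalisation
fixes the multiple up to sign. -/
lemma argmax_quadratic {p : ℕ} {Ω : Matrix (Fin p) (Fin p) ℝ} (hΩ : Ω.PosDef) {η : Fin p → ℝ}
    (hη : η ≠ 0) {V γ : (Fin p → ℝ) → ℝ} {a b : ℝ} (ha : 0 < a) (hb0 : 0 ≤ b)
    (hb : b * (η ⬝ᵥ (Ω *ᵥ η)) < a)
    (hV : ∀ d, V d = a * (d ⬝ᵥ (Ω *ᵥ d)) - b * (d ⬝ᵥ (Ω *ᵥ η)) ^ 2) {F : ℝ → ℝ}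
    (hF : StrictMonoOn F (Set.Ici 0)) (hγ : ∀ d, V d = 1 → γ d = F ((d ⬝ᵥ (Ω *ᵥ η)) ^ 2)) :
    (∀ d, d ≠ 0 → 0 < V d) ∧
    {d | V d = 1 ∧ IsMaxOn γ {d | V d = 1} d} =
      {(Real.sqrt (V η))⁻¹ • η, -((Real.sqrt (V η))⁻¹ • η)} := by
  set τ := η ⬝ᵥ (Ω *ᵥ η) with hτdef
  have hpos : ∀ d : Fin p → ℝ, d ≠ 0 → 0 < d ⬝ᵥ (Ω *ᵥ d) := fun d hd => by
    simpa using hΩ.dotProduct_mulVec_pos hd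
  have hτ : 0 < τ := hpos η hη
  have hsymm : ∀ d : Fin p → ℝ, η ⬝ᵥ (Ω *ᵥ d) = d ⬝ᵥ (Ω *ᵥ η) := fun d => by
    have h : Ωᵀ = Ω := by simpa [IsHermitian] using hΩ.isHermitian
    rw [dotProduct_mulVec, ← mulVec_transpose, h, dotProduct_comm]
  have hres : ∀ d : Fin p → ℝ,
      (d - (d ⬝ᵥ (Ω *ᵥ η) / τ) • η) ⬝ᵥ (Ω *ᵥ (d - (d ⬝ᵥ (Ω *ᵥ η) / τ) • η)) =
        d ⬝ᵥ (Ω *ᵥ d) - (d ⬝ᵥ (Ω *ᵥ η)) ^ 2 / τ := fun d => by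
    simp only [mulVec_sub, mulVec_smul, dotProduct_sub, sub_dotProduct, smul_dotProduct,
      dotProduct_smul, smul_eq_mul, hsymm, ← hτdef]
    field_simp
    ring
  have hnn : ∀ d : Fin p → ℝ, 0 ≤ d ⬝ᵥ (Ω *ᵥ d) := fun d => by
    rcases eq_or_ne d 0 with rfl | h
    · simp
    · exact (hpos d h).le
  have hCS : ∀ d : Fin p → ℝ, (d ⬝ᵥ (Ω *ᵥ η)) ^ 2 / τ ≤ d ⬝ᵥ (Ω *ᵥ d) := fun d => by
    have := hnn (d - (d ⬝ᵥ (Ω *ᵥ η) / τ) • η)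
    rw [hres] at this
    linarith
  have hVle : ∀ d : Fin p → ℝ, (a - b * τ) * (d ⬝ᵥ (Ω *ᵥ d)) ≤ V d := fun d => by
    have h := mul_le_mul_of_nonneg_left (hCS d) (mul_nonneg hb0 hτ.le)
    have e : b * τ * ((d ⬝ᵥ (Ω *ᵥ η)) ^ 2 / τ) = b * (d ⬝ᵥ (Ω *ᵥ η)) ^ 2 := by field_simp
    rw [e] at h
    rw [hV]
    linarith
  have hVη : V η = τ * (a - b * τ) := by
    rw [hV, ← hτdef]
    ring
  have hD : 0 < a - b * τ := by linarith
  have hVη0 : 0 < V η := hVη ▸ mul_pos hτ hD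
  have hVpos : ∀ d, d ≠ 0 → 0 < V d := fun d hd =>
    (mul_pos hD (hpos d hd)).trans_le (hVle d)
  have hVeq : ∀ d, V d = a * (d ⬝ᵥ (Ω *ᵥ d) - (d ⬝ᵥ (Ω *ᵥ η)) ^ 2 / τ) +
      (a - b * τ) / τ * (d ⬝ᵥ (Ω *ᵥ η)) ^ 2 := fun d => by
    rw [hV]
    field_simp
    ring
  have hbound : ∀ d, V d = 1 → (d ⬝ᵥ (Ω *ᵥ η)) ^ 2 ≤ τ / (a - b * τ) := fun d hd => by
    rw [hVeq] at hd
    have h1 := mul_nonneg ha.le (sub_nonneg.2 (hCS d))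
    have h2 : (a - b * τ) / τ * (d ⬝ᵥ (Ω *ᵥ η)) ^ 2 ≤ 1 := by linarith
    rw [le_div_iff₀ hD]
    rw [div_mul_eq_mul_div, div_le_one hτ] at h2
    linarith
  have hsmul : ∀ r : ℝ, r ^ 2 * V η = 1 → V (r • η) = 1 ∧
      ((r • η) ⬝ᵥ (Ω *ᵥ η)) ^ 2 = τ / (a - b * τ) := fun r hr => by
    have h1 : (r • η) ⬝ᵥ (Ω *ᵥ η) = r * τ := by simp [smul_dotProduct, ← hτdef]
    have h2 : (r • η) ⬝ᵥ (Ω *ᵥ (r • η)) = r ^ 2 * τ := by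
      simp only [smul_dotProduct, mulVec_smul, dotProduct_smul, smul_eq_mul, ← hτdef]
      ring
    rw [hVη] at hr
    constructor
    · rw [hV, h1, h2, ← hr]
      ring
    · rw [h1, eq_div_iff hD.ne']
      linear_combination τ * hr
  have hmax : ∀ r : ℝ, r ^ 2 * V η = 1 → V (r • η) = 1 ∧ IsMaxOn γ {d | V d = 1} (r • η) := by
    intro r hr
    obtain ⟨h1, h2⟩ := hsmul r hr
    refine ⟨h1, fun d hd => ?_⟩
    have hd' : V d = 1 := hd
    change γ d ≤ γ (r • η)
    rw [hγ d hd', hγ _ h1, h2]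
    exact hF.monotoneOn (Set.mem_Ici.2 (sq_nonneg _)) (div_nonneg hτ.le hD.le) (hbound d hd')
  have hs : (Real.sqrt (V η))⁻¹ ^ 2 * V η = 1 := by
    rw [inv_pow, Real.sq_sqrt hVη0.le, inv_mul_cancel₀ hVη0.ne']
  refine ⟨hVpos, Set.Subset.antisymm ?_ ?_⟩
  · rintro d ⟨hd1, hd2⟩
    obtain ⟨h1, h2⟩ := hsmul _ hs
    have hle : γ ((Real.sqrt (V η))⁻¹ • η) ≤ γ d := hd2 h1
    rw [hγ d hd1, hγ _ h1, h2, hF.le_iff_le (Set.mem_Ici.2 (div_nonneg hτ.le hD.le))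
      (Set.mem_Ici.2 (sq_nonneg _))] at hle
    have heq := le_antisymm (hbound d hd1) hle
    -- At the upper bound the `η`-part already uses up `V d = 1`, leaving no room for the residual.
    have hzero : d ⬝ᵥ (Ω *ᵥ d) - (d ⬝ᵥ (Ω *ᵥ η)) ^ 2 / τ = 0 := by
      have h3 := hVeq d
      have h4 : (a - b * τ) / τ * (τ / (a - b * τ)) = 1 := by field_simp
      rw [hd1, heq, h4] at h3
      rw [heq]
      have : a * (d ⬝ᵥ (Ω *ᵥ d) - τ / (a - b * τ) / τ) = 0 := by linarith
      exact (mul_eq_zero.1 this).resolve_left ha.ne'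
    have hdη : d = (d ⬝ᵥ (Ω *ᵥ η) / τ) • η := by
      by_contra hne
      have := hpos _ (sub_ne_zero.2 hne)
      rw [hres, hzero] at this
      exact this.false
    have hsq : (d ⬝ᵥ (Ω *ᵥ η) / τ) ^ 2 = (Real.sqrt (V η))⁻¹ ^ 2 := by
      rw [div_pow, heq, inv_pow, Real.sq_sqrt hVη0.le, hVη]
      field_simp
    rcases sq_eq_sq_iff_eq_or_eq_neg.1 hsq with h | h
    · left
      rw [← h]
      exact hdη
    · right
      rw [Set.mem_singleton_iff, ← neg_smul, ← h]
      exact hdη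
  · rintro d (rfl | hd)
    · exact hmax _ hs
    · rw [Set.mem_singleton_iff, ← neg_smul] at hd
      subst hd
      exact hmax _ (by rw [neg_sq, hs])

lemma strictMonoOn_mul_sq {A B c : ℝ} (hA : 0 < A) (hB : 0 ≤ B) (hc : 0 < c) :
    StrictMonoOn (fun x : ℝ => c * x * (A + B * x) ^ 2) (Set.Ici 0) := by
  intro x hx y hy hxy
  have hx0 : 0 ≤ x := hx
  have hy0 : 0 ≤ y := hy
  refine mul_lt_mul (mul_lt_mul_of_pos_left hxy hc) ?_ (by positivity) (by positivity)
  gcongr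

end SkewDE

/-! ### Assembly: the skewness as an increasing function of `(d'Ωη)²` -/

theorem mainTheorem3 {T : Type*} [MeasurableSpace T] (P : Measure T) :
    (MonotoneOn SkewDE.gFun (Set.Ici 1) ∧ SkewDE.gFun 1 = Real.pi / 2) ∧
    (∀ p : ℝ, 1 ≤ p → ∀ S : T → ℝ, HasLaw S (SkewDE.mixingLaw p) P →
      Integrable S P ∧ Integrable (fun t => S t ^ 2) P ∧
        (4 / Real.pi) * (∫ t, S t ∂P) ^ 2 ≥ ∫ t, S t ^ 2 ∂P) ∧
    (∀ (p : ℕ) (ξ : Fin p → ℝ) (Ω : Matrix (Fin p) (Fin p) ℝ) (α : Fin p → ℝ) (X : T → Fin p → ℝ),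
      1 ≤ p → Ω.PosDef → α ≠ 0 → HasLaw X (SkewDE.skewDoubleExponential ξ Ω α) P →
        (∀ i, MemLp (fun t => X t i) 3 P) ∧
        (SkewDE.covMatrix X P).PosDef ∧
        SkewDE.maxSkewDirs X P =
          {(Real.sqrt (SkewDE.shapeDir Ω α ⬝ᵥ
              (SkewDE.covMatrix X P *ᵥ SkewDE.shapeDir Ω α)))⁻¹ • SkewDE.shapeDir Ω α,
            -((Real.sqrt (SkewDE.shapeDir Ω α ⬝ᵥ
              (SkewDE.covMatrix X P *ᵥ SkewDE.shapeDir Ω α)))⁻¹ • SkewDE.shapeDir Ω α)}) := by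
  refine ⟨⟨SkewDE.monotoneOn_gFun, SkewDE.gFun_one⟩, fun p hp S hS => ?_,
    fun p ξ Ω α X hp hΩ hα hX => ?_⟩
  · have i1 := (SkewDE.mixingLaw_moment hp 1).1
    have i2 := (SkewDE.mixingLaw_moment hp 2).1
    simp only [pow_one] at i1
    have e1 : ∫ t, S t ∂P = ∫ s, s ∂SkewDE.mixingLaw p :=
      hS.integral_comp (f := fun s => s) (by fun_prop)
    have e2 : ∫ t, S t ^ 2 ∂P = ∫ s, s ^ 2 ∂SkewDE.mixingLaw p :=
      hS.integral_comp (f := fun s => s ^ 2) (by fun_prop)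
    rw [← hS.map_eq] at i1 i2
    refine ⟨i1.comp_aemeasurable hS.aemeasurable, i2.comp_aemeasurable hS.aemeasurable, ?_⟩
    rw [e1, e2]
    exact SkewDE.mixingLaw_moment_ratio hp
  · have hp' : (1 : ℝ) ≤ p := by exact_mod_cast hp
    set η := SkewDE.shapeDir Ω α with hη
    have hη0 : η ≠ 0 := fun h => hα <| by
      have := congrArg (SkewDE.scaleDiag Ω *ᵥ ·) h
      simpa [hη, SkewDE.shapeDir, mulVec_mulVec, Matrix.mul_nonsing_inv _
        (isUnit_iff_ne_zero.2 (SkewDE.scaleDiag_det_ne_zero hΩ))] using this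
    set τ := η ⬝ᵥ (Ω *ᵥ η) with hτdef
    have hτ : 0 < τ := by simpa using hΩ.dotProduct_mulVec_pos hη0
    obtain ⟨m₁, h₁⟩ : ∃ m₁, m₁ = ∫ s, s ∂SkewDE.mixingLaw p := ⟨_, rfl⟩
    obtain ⟨m₂, h₂⟩ : ∃ m₂, m₂ = ∫ s, s ^ 2 ∂SkewDE.mixingLaw p := ⟨_, rfl⟩
    obtain ⟨m₃, h₃⟩ : ∃ m₃, m₃ = ∫ s, s ^ 3 ∂SkewDE.mixingLaw p := ⟨_, rfl⟩
    have hm1 : 0 < m₁ := h₁ ▸ SkewDE.mixingLaw_moment_one_pos hp'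
    have hm2 : m₂ = 4 * (p + 1) := h₂ ▸ SkewDE.mixingLaw_moment_two hp'
    have hm3 : m₃ = 4 * (p + 2) * m₁ := by rw [h₁, h₃, SkewDE.mixingLaw_moment_three hp']
    have hm12 : m₁ ^ 2 ≤ m₂ := by rw [h₁, h₂]; exact SkewDE.mixingLaw_moment_one_sq_le hp'
    have hratio : m₂ ≤ 4 / Real.pi * m₁ ^ 2 := by
      rw [h₁, h₂]; exact SkewDE.mixingLaw_moment_ratio hp'
    have hm2p : 0 < m₂ := by rw [hm2]; positivity
    have hdiff : m₁ * m₂ < m₃ := by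
      rw [hm2, hm3]
      linarith
    obtain ⟨c, hc⟩ : ∃ c, c = Real.sqrt (2 / Real.pi) := ⟨_, rfl⟩
    have hpi := Real.pi_pos
    have hc0 : 0 < c := hc ▸ Real.sqrt_pos.2 (by positivity)
    have hc2 : c ^ 2 = 2 / Real.pi := by rw [hc, Real.sq_sqrt (by positivity)]
    have hc1 : c ^ 2 < 1 := by
      rw [hc2, div_lt_one hpi]
      linarith [Real.pi_gt_three]
    have hr : m₂ ≤ 2 * (m₁ ^ 2 * c ^ 2) := by
      rw [hc2]
      calc m₂ ≤ 4 / Real.pi * m₁ ^ 2 := hratio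
        _ = _ := by ring
    have hσ : Real.sqrt (1 + τ) ^ 2 = 1 + τ := Real.sq_sqrt (by positivity)
    have hvt := fun d => SkewDE.projection_var_and_third hp hΩ hα hX d rfl rfl hc h₁ h₂ h₃
    rw [← hη, ← hτdef] at hvt
    have hquad := SkewDE.covMatrix_quadratic hp hΩ hα hX
    have hlt : m₁ ^ 2 * c ^ 2 < m₂ := by nlinarith [pow_pos hm1 2]
    -- Holds since `τ/(1+τ) < 1` and `m₁²c² < m₂`.
    have hb : (m₁ * c) ^ 2 / (1 + τ) * τ < m₂ := by
      rw [div_mul_eq_mul_div, div_lt_iff₀ (by positivity)]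
      nlinarith
    have hA : 0 < 3 * (m₃ - m₁ * m₂) / m₂ := div_pos (by linarith) hm2p
    have hB : 0 ≤ 3 * (m₃ - m₁ * m₂) / m₂ * (m₁ * c) ^ 2 - m₃ + 2 * m₁ ^ 3 * c ^ 2 := by
      -- This grouping makes both terms nonnegative: each has a factor controlled by `m₂ ≤ 2m₁²c²`,
      -- which is the moment inequality of the second claim as `c² = 2/π`.
      have e : 3 * (m₃ - m₁ * m₂) / m₂ * (m₁ * c) ^ 2 - m₃ + 2 * m₁ ^ 3 * c ^ 2 =
          ((m₃ - m₁ * m₂) * (3 * (m₁ ^ 2 * c ^ 2) - m₂) +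
            m₁ * m₂ * (2 * (m₁ ^ 2 * c ^ 2) - m₂)) / m₂ := by
        field_simp
        ring
      rw [e]
      have := mul_nonneg (sub_nonneg.2 hdiff.le)
        (by nlinarith [sq_nonneg (m₁ * c)] : 0 ≤ 3 * (m₁ ^ 2 * c ^ 2) - m₂)
      have := mul_nonneg (mul_pos hm1 hm2p).le (sub_nonneg.2 hr)
      positivity
    set A := 3 * (m₃ - m₁ * m₂) / m₂ with hAdef
    set B := A * (m₁ * c) ^ 2 - m₃ + 2 * m₁ ^ 3 * c ^ 2 with hBdef
    obtain ⟨hpos, hset⟩ := SkewDE.argmax_quadratic hΩ hη0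
      (V := fun d => d ⬝ᵥ (SkewDE.covMatrix X P *ᵥ d))
      (γ := fun d => SkewDE.skewnessIndex (fun t => d ⬝ᵥ X t) P) (a := m₂)
      (b := (m₁ * c) ^ 2 / (1 + τ)) hm2p (by positivity) hb
      (fun d => by
        rw [hquad, (hvt d).1, mul_pow, div_pow, hσ]
        ring)
      (SkewDE.strictMonoOn_mul_sq (A := A) (B := B / (1 + τ)) (c := c ^ 2 / (1 + τ)) hA
        (by positivity) (by positivity))
      (fun d hd => by
        rw [hquad] at hd
        have hd' := (hvt d).1
        have h3 := (hvt d).2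
        rw [hd] at hd'
        rw [SkewDE.skewnessIndex, hd, Real.sqrt_one]
        simp only [div_one]
        rw [h3]
        set s := Real.sqrt (1 + τ)
        set h := d ⬝ᵥ (Ω *ᵥ η)
        have hs0 : s ≠ 0 := fun h0 => by
          rw [h0] at hσ
          linarith
        -- The unit-variance constraint solved for `d'Ωd`; the third moment then depends on `d` only
        -- through `h`.
        have hq : d ⬝ᵥ (Ω *ᵥ d) = (1 + (m₁ * c * (h / s)) ^ 2) / m₂ := by
          rw [eq_div_iff hm2p.ne']
          linarith
        have key : m₃ * (c * (3 * (d ⬝ᵥ (Ω *ᵥ d)) * (h / s) - (h / s) ^ 3)) -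
            3 * (m₂ * (d ⬝ᵥ (Ω *ᵥ d))) * (m₁ * c * (h / s)) + 2 * (m₁ * c * (h / s)) ^ 3 =
            c * (h / s) * (A + B * (h / s) ^ 2) := by
          rw [hq, hBdef, hAdef]
          field_simp
          ring
        rw [key, ← hσ]
        field_simp)
    refine ⟨fun i => ?_, ?_, hset⟩
    · simpa [single_dotProduct] using SkewDE.memLp_projection hp hΩ hα hX (Pi.single i 1)
    · refine Matrix.PosDef.of_dotProduct_mulVec_pos ?_ fun d hd => by simpa using hpos d hd
      ext i j
      simp only [SkewDE.covMatrix, conjTranspose_apply, Matrix.of_apply, star_trivial]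
      exact covariance_comm _ _
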